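/- For $\beta\in(0,1)$ consider Kertz's equation $$\int_0^1\frac{dz}{(\beta^{-1}-1)-z(\log z-1)}=1 .\tag{K}$$ For independent random variables $\mathbf X=\{X_1,\dots,X_n\}$ with values in $[0,\infty)$, whose distributions are known, let $\mathsf{MAX}(\mathbf X)=\mathbb E[\max_i X_i]\in[0,\infty]$, and let $\mathsf{OPT}(\mathbf X)\in[0,\infty]$ be the supremum of the expected reward of an online policy when the variables arrive in uniformly random order: at each step the index and the value of the arriving variable are revealed, and the policy, knowing only the history so far, either takes this value and stops, or discards it for ever (the reward is $0$ if nothing is taken). For $0\le\varepsilon\le1$ the variable $X_i$ with c.d.f. $F_i$ is $\varepsilon$-small if $1-F_i(r)\le\varepsilon$ for all $r>0$, i.e. $\Pr[X_i>0]\le\varepsilon$. Let $F(r)=\Pr[\max_i X_i\le r]$ for $r\ge 0$ and $F^{-1}(v)=\inf\{r\ge0: F(r)\ge v\}$. 1. Equation (K) has exactly one solution $\beta\in(0,1)$ (the Kertz bound). 2. A real number $\beta$ is the Kertz bound if and only if there is a differentiable function $y:[0,1]\to[0,1]$, with $\log y$ integrable on $[0,1]$, such that $$\exp\Big(\int_0^t\log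 y(s)\,ds\Big)=-\beta\,y'(t)\quad(0\le t\le1),\qquad y(0)=1,\quad y(1)=0. \tag{ODE}$$ 3. Let $\beta$ be the Kertz bound. There is an absolute constant $C>0$ such that for all $\varepsilon\in[0,1]$, all $n$ and all independent non-negative $\varepsilon$-small variables $\mathbf X=\{X_1,\dots,X_n\}$ (not necessarily identically distributed), $$\mathsf{OPT}(\mathbf X)\ \ge\ (\beta-C\varepsilon)\cdot\mathsf{MAX}(\mathbf X).$$ If moreover $F$ is continuous on $[0,\infty)$ (an atom of the $X_i$ at $0$ is allowed), this is achieved by a time-based threshold policy: for every solution $y$ of (ODE), let $r(t)=F^{-1}(y(t))$, let the variables arrive at independent uniform times $t_i\in[0,1]$, and, as long as nothing has been taken, take the variable arriving at time $t_i$ with probability $(1-\varepsilon)^2$ (independently of everything else) if $X_i>0$ and $X_i\ge r(t_i)$. The expected reward $\mathsf{ALG}$ of this policy satisfies $$\mathsf{OPT}(\mathbf X)\ \ge\ \mathsf{ALG}\ \ge\ (\beta-C\varepsilon)\cdot\mathsf{MAX}(\mathbf X),$$ with the same absolute constant $C$. -/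

import Mathlib

open MeasureTheory ProbabilityTheory
open scoped NNReal ENNReal

noncomputable section

namespace SmallProphets

/-! ### The Kertz bound and the threshold equation -/

/-- `β` is a Kertz bound: a number in `(0, 1)` that solves Kertz's integral equation. The integrand
is continuous on `[0, 1]`, since `z * log z` tends to `0 = 0 * Real.log 0` at `0`. -/
structure IsKertzBound (β : ℝ) : Prop where
  pos : 0 < β
  lt_one : β < 1
  integral_eq : ∫ z in (0 : ℝ)..1, ((β⁻¹ - 1) - z * (Real.log z - 1))⁻¹ = 1

/-- `y : [0, 1] → [0, 1]` solves the boundary value problem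
`exp (∫₀ᵗ log y(s) ds) = -β y'(t)`, `y(0) = 1`, `y(1) = 0`. The derivative at the end points is
one-sided, and the integral is required to converge. -/
structure SolvesThresholdODE (β : ℝ) (y : ℝ → ℝ) : Prop where
  mem_Icc : ∀ t ∈ Set.Icc (0 : ℝ) 1, y t ∈ Set.Icc (0 : ℝ) 1
  y_zero : y 0 = 1
  y_one : y 1 = 0
  log_integrable : IntervalIntegrable (fun s => Real.log (y s)) volume 0 1
  differentiable : DifferentiableOn ℝ y (Set.Icc 0 1)
  equation : ∀ t ∈ Set.Icc (0 : ℝ) 1,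
    Real.exp (∫ s in (0 : ℝ)..t, Real.log (y s)) = -β * derivWithin y (Set.Icc 0 1) t

/-! ### Random variables, the prophet -/

variable {Ω : Type*} [MeasurableSpace Ω]

/-- The c.d.f. of a non-negative random variable. -/
def cdfNN (P : Measure Ω) (Y : Ω → ℝ≥0) (r : ℝ≥0) : ℝ := P.real {ω | Y ω ≤ r}

/-- `Y` is `(ε, δ)`-small: `1 - F(r) ≤ ε` for every `r > δ`. -/
def IsSmall (P : Measure Ω) (Y : Ω → ℝ≥0) (ε : ℝ) (δ : ℝ≥0) : Prop :=
  ∀ r : ℝ≥0, δ < r → 1 - cdfNN P Y r ≤ ε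

/-- The value of the prophet, `E[max_i X_i]`. -/
def MAX (P : Measure Ω) {n : ℕ} (X : Fin n → Ω → ℝ≥0) : ℝ≥0∞ :=
  ∫⁻ ω, ⨆ i, (X i ω : ℝ≥0∞) ∂P

/-- The c.d.f. of `max_i X_i`, as a function on `[0, ∞)`. -/
def maxCDF (P : Measure Ω) {n : ℕ} (X : Fin n → Ω → ℝ≥0) (r : ℝ≥0) : ℝ :=
  P.real {ω | ∀ i, X i ω ≤ r}

/-- The (generalized) inverse `F⁻¹(v) = inf {r ≥ 0 : F(r) ≥ v}` of the c.d.f. of `max_i X_i`.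
For `v < 1` the set is not empty. -/
def maxCDFInv (P : Measure Ω) {n : ℕ} (X : Fin n → Ω → ℝ≥0) (v : ℝ) : ℝ≥0 :=
  sInf {r : ℝ≥0 | v ≤ maxCDF P X r}

/-! ### Online policies and the random order optimum -/

/-- What is known once the boxes in positions `0, …, k` have been opened: the identities of these
boxes, in order of arrival, and the values inside. -/
def history {n : ℕ} (σ : Equiv.Perm (Fin n)) (x : Fin n → ℝ≥0) (k : Fin n) :
    Set.Iic k → Fin n × ℝ≥0 :=
  fun j => (σ j, x (σ j))

/-- An online policy for `n` boxes: for each position `k`, the (measurable) set of histories after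
which the box just opened is taken. -/
structure Policy (n : ℕ) where
  accept : (k : Fin n) → Set (Set.Iic k → Fin n × ℝ≥0)
  measurable_accept : ∀ k, MeasurableSet (accept k)

/-- The policy stops at position `k` when the boxes arrive in the order `σ 0, σ 1, …` and box `i`
contains `x i`: the `k`-th box is the first one that is accepted. -/
def Policy.StopsAt {n : ℕ} (p : Policy n) (σ : Equiv.Perm (Fin n)) (x : Fin n → ℝ≥0)
    (k : Fin n) : Prop :=
  history σ x k ∈ p.accept k ∧ ∀ j < k, history σ x j ∉ p.accept j

open Classical in
/-- The reward of a policy: the value of the box it takes, and `0` if it takes none. -/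
def Policy.reward {n : ℕ} (p : Policy n) (σ : Equiv.Perm (Fin n)) (x : Fin n → ℝ≥0) : ℝ≥0∞ :=
  ∑ k, if p.StopsAt σ x k then (x (σ k) : ℝ≥0∞) else 0

/-- The expected reward of a policy when the boxes arrive in uniformly random order. -/
def Policy.value (P : Measure Ω) {n : ℕ} (X : Fin n → Ω → ℝ≥0) (p : Policy n) : ℝ≥0∞ :=
  (∑ σ : Equiv.Perm (Fin n), ∫⁻ ω, p.reward σ (fun i => X i ω) ∂P) / (n.factorial : ℝ≥0∞)

/-- The optimal expected reward of an online policy in random order. -/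
def OPT (P : Measure Ω) {n : ℕ} (X : Fin n → Ω → ℝ≥0) : ℝ≥0∞ :=
  ⨆ p : Policy n, p.value P X

/-! ### Time-based threshold policies -/

/-- Box `i` qualifies: its value is positive and at least the threshold `r` at its arrival time
`t i`, and its coin (`u i` uniform on `[0, 1]`, heads with probability `q`) shows heads. -/
def Qualifies {n : ℕ} (r : ℝ → ℝ≥0) (q : ℝ) (t u : Fin n → unitInterval) (x : Fin n → ℝ≥0)
    (i : Fin n) : Prop :=
  0 < x i ∧ r (t i) ≤ x i ∧ (u i : ℝ) ≤ q

open Classical in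
/-- The reward of the time-based policy: the value of the qualifying box that arrives first. -/
def timeReward {n : ℕ} (r : ℝ → ℝ≥0) (q : ℝ) (t u : Fin n → unitInterval)
    (x : Fin n → ℝ≥0) : ℝ≥0∞ :=
  ∑ i, if Qualifies r q t u x i ∧ ∀ j, j ≠ i → Qualifies r q t u x j → t i < t j
    then (x i : ℝ≥0∞) else 0

/-- The expected reward of the policy that takes a variable arriving at time `t` with probability
`q` if its value is at least `r t`; arrival times and coins are independent, uniform on `[0, 1]`
and independent of the variables. -/
def ALG (P : Measure Ω) {n : ℕ} (X : Fin n → Ω → ℝ≥0) (r : ℝ → ℝ≥0) (q : ℝ) : ℝ≥0∞ :=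
  ∫⁻ z : Ω × (Fin n → unitInterval) × (Fin n → unitInterval),
    timeReward r q z.2.1 z.2.2 (fun i => X i z.1) ∂(P.prod (volume.prod volume))

end SmallProphets

end

noncomputable section

namespace SmallProphets


/-! ### Kertz's equation -/

/-! Write `D(z) = c + z - z log z` with `c = β⁻¹ - 1`, and `E(t) = exp (∫₀ᵗ log y)`. Along a
solution of the threshold equation `E` and `β D(y)` have the same derivative and both equal `1` at
`0`. So the equation is the autonomous one `y' = -D(y)`, which runs from `1` to `0` in time `∫₀¹ dz
/ D(z)`. This time is `1` exactly when Kertz's equation holds, and it is strictly decreasing in `c`.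

For continuous `F`, three estimates bound the policy from below. (a) Nothing has been taken before
time `s` with probability at least `E(s)`: the thinning by `(1 - ε)²` turns each factor into at
least an exponential (`exp_neg_le_one_sub_mul`), and `∏ (1 - passProb) ≥ y` bounds the exponents
(`SolvesThresholdODE.expIntegralLog_le`). (b) The tails at level `max (r(s), x)` sum to at least `(1
- ε)` times `-log max (y(s), F(x))`. (c) Since `E = -β y'`, the substitution `z = y(s)` gives `∫
-log max (y, v) · E = β ∫₀¹ -log max (z, v) dz = β (1 - v)`. With `v = F(x)`, integrating over `x`
gives `(1 - ε)³ β · MAX`.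

The policy is a mixture of online policies, so `ALG ≤ OPT`. A general `F` is reduced to a continuous
one by independent random factors in `[1, 1 + η]`, at the cost of a factor `1 + η`. -/

/-- The denominator of Kertz's integrand. -/
def kertzDenom (c z : ℝ) : ℝ := c - z * (Real.log z - 1)

lemma kertzDenom_eq (c z : ℝ) : kertzDenom c z = c + z + Real.negMulLog z := by
  simp only [kertzDenom, Real.negMulLog]; ring

lemma kertzDenom_one (c : ℝ) : kertzDenom c 1 = c + 1 := by simp [kertzDenom]

lemma kertzDenom_zero (c : ℝ) : kertzDenom c 0 = c := by simp [kertzDenom]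

lemma continuous_kertzDenom (c : ℝ) : Continuous (kertzDenom c) := by
  have := Real.continuous_negMulLog
  simp only [funext (kertzDenom_eq c)]
  fun_prop

lemma kertzDenom_ge {c z : ℝ} (h0 : 0 ≤ z) (h1 : z ≤ 1) : c + z ≤ kertzDenom c z := by
  have := Real.negMulLog_nonneg h0 h1
  rw [kertzDenom_eq]; linarith

lemma kertzDenom_pos {c z : ℝ} (hc : 0 < c) (h0 : 0 ≤ z) (h1 : z ≤ 1) : 0 < kertzDenom c z := by
  linarith [kertzDenom_ge (c := c) h0 h1]

/-- The denominator is concave with slope `-log z`; the right-hand side is its tangent at `exp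
(-a)`. -/
lemma kertzDenom_le_tangent {c z a : ℝ} (h0 : 0 ≤ z) :
    kertzDenom c z ≤ c + Real.exp (-a) + a * z := by
  rcases h0.eq_or_lt with rfl | hz
  · rw [kertzDenom_zero]; linarith [Real.exp_pos (-a)]
  have h := Real.add_one_le_exp (-a - Real.log z)
  rw [Real.exp_sub, Real.exp_log hz, le_div_iff₀ hz] at h
  simp only [kertzDenom]; nlinarith

lemma kertzDenom_le {c z : ℝ} (h0 : 0 ≤ z) : kertzDenom c z ≤ c + 1 := by
  simpa using kertzDenom_le_tangent (c := c) (a := 0) h0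

lemma hasDerivAt_kertzDenom (c : ℝ) {z : ℝ} (hz : z ≠ 0) :
    HasDerivAt (kertzDenom c) (-Real.log z) z := by
  have h := ((hasDerivAt_id z).const_add c).add (Real.hasDerivAt_negMulLog hz)
  rw [show kertzDenom c = (fun x => c + id x) + Real.negMulLog from funext (kertzDenom_eq c)]
  exact h.congr_deriv (by ring)

/-- The left-hand side of Kertz's equation, as a function of `c = β⁻¹ - 1`. -/
def kertzIntegral (c : ℝ) : ℝ := ∫ z in (0 : ℝ)..1, (kertzDenom c z)⁻¹

lemma continuousOn_kertzDenom_inv {c : ℝ} (hc : 0 < c) :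
    ContinuousOn (fun z => (kertzDenom c z)⁻¹) (Set.Icc 0 1) :=
  (continuous_kertzDenom c).continuousOn.inv₀ fun _ hz => (kertzDenom_pos hc hz.1 hz.2).ne'

lemma kertzIntegral_strictAntiOn : StrictAntiOn kertzIntegral (Set.Ioi 0) := by
  intro c hc d hd hcd
  have key : ∀ z ∈ Set.Icc (0 : ℝ) 1, (kertzDenom d z)⁻¹ < (kertzDenom c z)⁻¹ := fun z hz =>
    inv_strictAnti₀ (kertzDenom_pos hc hz.1 hz.2) (by simp only [kertzDenom]; linarith)
  exact intervalIntegral.integral_lt_integral_of_continuousOn_of_le_of_exists_lt one_pos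
    (continuousOn_kertzDenom_inv hd) (continuousOn_kertzDenom_inv hc)
    (fun z hz => (key z ⟨hz.1.le, hz.2⟩).le) ⟨0, by simp, key 0 (by simp)⟩

lemma continuous_kertzIntegral_exp : Continuous fun a : ℝ => kertzIntegral (Real.exp a) := by
  -- The absolute value keeps the denominator positive on the whole plane and changes nothing for
  -- `z` in `[0, 1]`.
  have hc : Continuous fun p : ℝ × ℝ => (Real.exp p.1 + |p.2 + Real.negMulLog p.2|)⁻¹ := by
    have := Real.continuous_negMulLog
    exact Continuous.inv₀ (by fun_prop) fun p => by positivity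
  have h := intervalIntegral.continuous_parametric_intervalIntegral_of_continuous'
    (μ := volume) (f := fun a z => (Real.exp a + |z + Real.negMulLog z|)⁻¹) hc 0 1
  refine h.congr fun a => intervalIntegral.integral_congr fun z hz => ?_
  rw [Set.uIcc_of_le zero_le_one] at hz
  have := Real.negMulLog_nonneg hz.1 hz.2
  simp only [kertzDenom_eq]
  rw [abs_of_nonneg (by linarith [hz.1]), add_assoc]

lemma kertzIntegral_one_le : kertzIntegral 1 ≤ 1 := by
  have h : kertzIntegral 1 ≤ ∫ _ in (0 : ℝ)..1, (1 : ℝ) := by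
    refine intervalIntegral.integral_mono_on zero_le_one
      ((continuousOn_kertzDenom_inv one_pos).intervalIntegrable_of_Icc zero_le_one)
      intervalIntegrable_const fun z hz => ?_
    exact inv_le_one_of_one_le₀ (by linarith [kertzDenom_ge (c := 1) hz.1 hz.2, hz.1])
  simpa using h

/-- The tangent of slope `2` bounds the integral below by `log (1 + e²) / 2`, which exceeds `1`. -/
lemma one_le_kertzIntegral : 1 ≤ kertzIntegral (Real.exp (-2)) := by
  set b : ℝ := Real.exp (-2) + Real.exp (-2) with hb
  have hb0 : 0 < b := by positivity
  have hpos : ∀ z ∈ Set.Icc (0 : ℝ) 1, 0 < b + 2 * z := fun z hz => by linarith [hz.1]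
  have hint : IntervalIntegrable (fun z => (b + 2 * z)⁻¹) volume 0 1 := by
    refine ContinuousOn.intervalIntegrable_of_Icc zero_le_one ?_
    exact ContinuousOn.inv₀ (by fun_prop) fun z hz => (hpos z hz).ne'
  have h1 : ∫ z in (0 : ℝ)..1, (b + 2 * z)⁻¹ ≤ kertzIntegral (Real.exp (-2)) := by
    refine intervalIntegral.integral_mono_on zero_le_one hint
      ((continuousOn_kertzDenom_inv (Real.exp_pos _)).intervalIntegrable_of_Icc zero_le_one)
      fun z hz => ?_
    exact inv_anti₀ (kertzDenom_pos (Real.exp_pos _) hz.1 hz.2) (kertzDenom_le_tangent hz.1)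
  have h2 : ∫ z in (0 : ℝ)..1, (b + 2 * z)⁻¹
      = Real.log (b + 2 * 1) / 2 - Real.log (b + 2 * 0) / 2 := by
    refine intervalIntegral.integral_eq_sub_of_hasDerivAt (f := fun z => Real.log (b + 2 * z) / 2)
      (fun z hz => ?_) hint
    rw [Set.uIcc_of_le zero_le_one] at hz
    have h := (((hasDerivAt_id z).const_mul 2).const_add b).log (hpos z hz).ne'
    exact (h.div_const 2).congr_deriv (by simp [div_eq_mul_inv]; ring)
  have h3 : Real.exp 2 * b ≤ b + 2 * 1 := by
    have : Real.exp 2 * Real.exp (-2) = 1 := by rw [← Real.exp_add]; simp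
    rw [hb]; nlinarith [Real.exp_pos (-2)]
  have h4 := Real.log_le_log (by positivity) h3
  rw [Real.log_mul (Real.exp_pos 2).ne' hb0.ne', Real.log_exp] at h4
  rw [h2, mul_zero, add_zero, ← sub_div] at h1
  refine le_trans ?_ h1
  rw [le_div_iff₀ two_pos]
  linarith

lemma isKertzBound_iff {β : ℝ} :
    IsKertzBound β ↔ 0 < β ∧ β < 1 ∧ kertzIntegral (β⁻¹ - 1) = 1 :=
  ⟨fun h => ⟨h.pos, h.lt_one, h.integral_eq⟩, fun h => ⟨h.1, h.2.1, h.2.2⟩⟩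

lemma existsUnique_isKertzBound : ∃! β : ℝ, IsKertzBound β := by
  obtain ⟨a, -, ha⟩ := intermediate_value_Icc' (show (-2 : ℝ) ≤ 0 by norm_num)
    continuous_kertzIntegral_exp.continuousOn
    (show (1 : ℝ) ∈ Set.Icc _ _ from
      ⟨by simpa using kertzIntegral_one_le, one_le_kertzIntegral⟩)
  have he := Real.exp_pos a
  refine ⟨(Real.exp a + 1)⁻¹, isKertzBound_iff.2 ⟨by positivity,
    inv_lt_one_of_one_lt₀ (by linarith), by simpa using ha⟩, fun β hβ => ?_⟩
  obtain ⟨h0, h1, h2⟩ := isKertzBound_iff.1 hβ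
  have hc : 0 < β⁻¹ - 1 := sub_pos.2 ((one_lt_inv₀ h0).2 h1)
  have := kertzIntegral_strictAntiOn.injOn hc he (h2.trans ha.symm)
  rw [← this]; simp


/-! ### The threshold equation -/

/-- The left-hand side of the threshold equation. -/
def expIntegralLog (y : ℝ → ℝ) (t : ℝ) : ℝ := Real.exp (∫ s in (0 : ℝ)..t, Real.log (y s))

lemma expIntegralLog_pos (y : ℝ → ℝ) (t : ℝ) : 0 < expIntegralLog y t := Real.exp_pos _

lemma expIntegralLog_zero (y : ℝ → ℝ) : expIntegralLog y 0 = 1 := by simp [expIntegralLog]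

namespace SolvesThresholdODE

variable {β : ℝ} {y : ℝ → ℝ}

lemma continuousOn (h : SolvesThresholdODE β y) : ContinuousOn y (Set.Icc 0 1) :=
  h.differentiable.continuousOn

lemma continuousOn_expIntegralLog (h : SolvesThresholdODE β y) :
    ContinuousOn (expIntegralLog y) (Set.Icc 0 1) := by
  have := intervalIntegral.continuousOn_primitive_interval' h.log_integrable (a := 0) (by simp)
  rw [Set.uIcc_of_le zero_le_one] at this
  exact this.rexp

lemma ne_zero (h : SolvesThresholdODE β y) : β ≠ 0 := by
  rintro rfl
  have := h.equation 0 (by simp)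
  simp at this

lemma hasDerivWithinAt (h : SolvesThresholdODE β y) {t : ℝ} (ht : t ∈ Set.Icc (0 : ℝ) 1) :
    HasDerivWithinAt y (-(β⁻¹ * expIntegralLog y t)) (Set.Icc 0 1) t := by
  refine (h.differentiable t ht).hasDerivWithinAt.congr_deriv ?_
  rw [expIntegralLog, h.equation t ht]
  field_simp [h.ne_zero]

lemma hasDerivAt (h : SolvesThresholdODE β y) {t : ℝ} (ht : t ∈ Set.Ioo (0 : ℝ) 1) :
    HasDerivAt y (-(β⁻¹ * expIntegralLog y t)) t :=
  (h.hasDerivWithinAt (Set.Ioo_subset_Icc_self ht)).hasDerivAt (Icc_mem_nhds ht.1 ht.2)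

/-- For negative `β` the solution would increase, against `y 0 = 1` and `y 1 = 0`. -/
lemma pos (h : SolvesThresholdODE β y) : 0 < β := by
  by_contra hβ
  have hβ : β⁻¹ < 0 := inv_lt_zero.2 (lt_of_le_of_ne (not_lt.1 hβ) h.ne_zero)
  have hmono : StrictMonoOn y (Set.Icc 0 1) := by
    refine strictMonoOn_of_deriv_pos (convex_Icc 0 1) h.continuousOn fun t ht => ?_
    rw [interior_Icc] at ht
    rw [(h.hasDerivAt ht).deriv]
    have := mul_pos_of_neg_of_neg hβ (neg_neg_of_pos (expIntegralLog_pos y t))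
    linarith
  have := hmono (by simp) (by simp) (zero_lt_one' ℝ)
  rw [h.y_zero, h.y_one] at this
  exact absurd this (by norm_num)

lemma strictAntiOn (h : SolvesThresholdODE β y) : StrictAntiOn y (Set.Icc 0 1) := by
  refine strictAntiOn_of_deriv_neg (convex_Icc 0 1) h.continuousOn fun t ht => ?_
  rw [interior_Icc] at ht
  rw [(h.hasDerivAt ht).deriv]
  have := mul_pos (inv_pos.2 h.pos) (expIntegralLog_pos y t)
  linarith

lemma pos_of_lt_one (h : SolvesThresholdODE β y) {t : ℝ} (h0 : 0 ≤ t) (h1 : t < 1) : 0 < y t := by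
  have := h.strictAntiOn ⟨h0, h1.le⟩ (by simp) h1
  rwa [h.y_one] at this

lemma hasDerivAt_expIntegralLog (h : SolvesThresholdODE β y) {t : ℝ} (ht : t ∈ Set.Ioo (0 : ℝ) 1) :
    HasDerivAt (expIntegralLog y) (expIntegralLog y t * Real.log (y t)) t := by
  have hlog : ContinuousOn (fun s => Real.log (y s)) (Set.Ioo 0 1) :=
    (h.continuousOn.mono Set.Ioo_subset_Icc_self).log
      fun s hs => (h.pos_of_lt_one hs.1.le hs.2).ne'
  refine (intervalIntegral.integral_hasDerivAt_right ?_ ?_ ?_).exp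
  · refine h.log_integrable.mono_set ?_
    rw [Set.uIcc_of_le zero_le_one, Set.uIcc_of_le ht.1.le]
    exact Set.Icc_subset_Icc_right ht.2.le
  · exact hlog.stronglyMeasurableAtFilter isOpen_Ioo t ht
  · exact hlog.continuousAt (isOpen_Ioo.mem_nhds ht)

/-- A conservation law: both sides have derivative `-β y' log y` inside the interval, and both are
`1` at `0` because `β (c + 1) = 1`. -/
lemma expIntegralLog_eq (h : SolvesThresholdODE β y) {t : ℝ} (ht : t ∈ Set.Icc (0 : ℝ) 1) :
    expIntegralLog y t = β * kertzDenom (β⁻¹ - 1) (y t) := by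
  have hβ := h.ne_zero
  set D : ℝ → ℝ := fun t => expIntegralLog y t - β * kertzDenom (β⁻¹ - 1) (y t) with hD
  have hcont : ContinuousOn D (Set.Icc 0 1) := h.continuousOn_expIntegralLog.sub
    (((continuous_kertzDenom _).comp_continuousOn h.continuousOn).const_smul β)
  have hder : ∀ s ∈ interior (Set.Icc (0 : ℝ) 1), HasDerivAt D 0 s := by
    intro s hs
    rw [interior_Icc] at hs
    have h1 := (h.hasDerivAt_expIntegralLog hs).sub (((hasDerivAt_kertzDenom (β⁻¹ - 1)
      (h.pos_of_lt_one hs.1.le hs.2).ne').comp s (h.hasDerivAt hs)).const_mul β)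
    refine h1.congr_deriv ?_
    field_simp
    ring
  have hdiff : DifferentiableOn ℝ D (interior (Set.Icc (0 : ℝ) 1)) :=
    fun s hs => (hder s hs).differentiableAt.differentiableWithinAt
  have h0 : D 0 = 0 := by
    simp only [hD, expIntegralLog_zero, h.y_zero, kertzDenom_one]
    field_simp
    ring
  have hmono := monotoneOn_of_deriv_nonneg (convex_Icc 0 1) hcont hdiff
    fun s hs => (hder s hs).deriv.ge
  have hanti := antitoneOn_of_deriv_nonpos (convex_Icc 0 1) hcont hdiff
    fun s hs => (hder s hs).deriv.le
  have h1 := hmono (by simp) ht ht.1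
  have h2 := hanti (by simp) ht ht.1
  rw [h0] at h1 h2
  exact sub_eq_zero.1 (le_antisymm h2 h1)

/-- Integration along a solution: the substitution `z = y t`. -/
lemma integral_comp_mul_expIntegralLog (h : SolvesThresholdODE β y) {g : ℝ → ℝ}
    (hg : ContinuousOn g (Set.Icc 0 1)) :
    ∫ t in (0 : ℝ)..1, g (y t) * expIntegralLog y t = β * ∫ z in (0 : ℝ)..1, g z := by
  have himage : y '' Set.uIcc 0 1 ⊆ Set.Icc 0 1 := by
    rw [Set.uIcc_of_le zero_le_one]
    rintro _ ⟨t, ht, rfl⟩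
    exact h.mem_Icc t ht
  have hsub := intervalIntegral.integral_comp_mul_deriv'' (f := y) (a := 0) (b := 1)
    (f' := fun t => -(β⁻¹ * expIntegralLog y t)) (g := g)
    (by rw [Set.uIcc_of_le zero_le_one]; exact h.continuousOn)
    (fun t ht => (h.hasDerivAt (by simpa using ht)).hasDerivWithinAt)
    (by
      rw [Set.uIcc_of_le zero_le_one]
      exact (h.continuousOn_expIntegralLog.const_smul β⁻¹).neg)
    (hg.mono himage)
  rw [h.y_zero, h.y_one, intervalIntegral.integral_symm (0 : ℝ) 1] at hsub
  have hβ := h.ne_zero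
  have heq : ∀ t, (g ∘ y) t * (-(β⁻¹ * expIntegralLog y t))
      = -β⁻¹ * (g (y t) * expIntegralLog y t) := fun t => by simp only [Function.comp]; ring
  simp only [heq, intervalIntegral.integral_const_mul] at hsub
  field_simp at hsub
  linarith

/-- At `t = 1` the conservation law reads `E(1) = β c`, so `c > 0`, that is `β < 1`. Substituting
with `g = 1 / D` makes the integrand the constant `β`. -/
lemma isKertzBound (h : SolvesThresholdODE β y) : IsKertzBound β := by
  have hβ := h.pos
  have hc : 0 < β⁻¹ - 1 := by
    have h1 := h.expIntegralLog_eq (t := 1) (by simp)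
    rw [h.y_one, kertzDenom_zero] at h1
    exact pos_of_mul_pos_right (h1 ▸ expIntegralLog_pos y 1) hβ.le
  refine isKertzBound_iff.2 ⟨hβ, (one_lt_inv₀ hβ).1 (by linarith), ?_⟩
  have h1 := h.integral_comp_mul_expIntegralLog (continuousOn_kertzDenom_inv hc)
  have h2 : ∫ t in (0 : ℝ)..1, (kertzDenom (β⁻¹ - 1) (y t))⁻¹ * expIntegralLog y t
      = ∫ _ in (0 : ℝ)..1, β := by
    refine intervalIntegral.integral_congr fun t ht => ?_
    rw [Set.uIcc_of_le zero_le_one] at ht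
    have hm := h.mem_Icc t ht
    have := (kertzDenom_pos hc hm.1 hm.2).ne'
    simp only [h.expIntegralLog_eq ht]
    rw [mul_left_comm, inv_mul_cancel₀ this, mul_one]
  rw [h2] at h1
  simp only [intervalIntegral.integral_const, sub_zero, one_smul] at h1
  exact (mul_left_cancel₀ hβ.ne' ((mul_one β).trans h1)).symm

end SolvesThresholdODE

/-- Separation of variables: `y(t) = H⁻¹(1 - t)` with `H(z) = ∫₀ᶻ 1 / D`. -/
lemma exists_hasDerivAt_neg_kertzDenom {c : ℝ} (hc : 0 < c) (h : kertzIntegral c = 1) :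
    ∃ y : ℝ → ℝ, y 0 = 1 ∧ y 1 = 0 ∧ (∀ t ∈ Set.Icc (0 : ℝ) 1, y t ∈ Set.Icc (0 : ℝ) 1) ∧
      (∀ t < 1, 0 < y t) ∧
      ∀ t ∈ Set.Icc (0 : ℝ) 1, HasDerivAt y (-kertzDenom c (y t)) t := by
  -- Freezing the denominator outside `[0, 1]` makes `H` a bijection of the whole line, so that `y`
  -- has two-sided derivatives at the end points too.
  set p : ℝ → ℝ := fun z => Set.projIcc (0 : ℝ) 1 zero_le_one z with hp
  have hpm : ∀ z, p z ∈ Set.Icc (0 : ℝ) 1 := fun z => Subtype.mem _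
  have hpid : ∀ z ∈ Set.Icc (0 : ℝ) 1, p z = z := fun z hz => by
    simp only [hp, Set.projIcc_of_mem zero_le_one hz]
  set k : ℝ → ℝ := fun z => (kertzDenom c (p z))⁻¹ with hk
  have hkpos : ∀ z, 0 < kertzDenom c (p z) := fun z => kertzDenom_pos hc (hpm z).1 (hpm z).2
  have hkcont : Continuous k :=
    ((continuous_kertzDenom c).comp (continuous_subtype_val.comp continuous_projIcc)).inv₀
      fun z => (hkpos z).ne'
  set H : ℝ → ℝ := fun z => ∫ w in (0 : ℝ)..z, k w with hH
  have hHd : ∀ z, HasDerivAt H (k z) z := fun z =>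
    intervalIntegral.integral_hasDerivAt_right (hkcont.intervalIntegrable _ _)
      hkcont.stronglyMeasurable.stronglyMeasurableAtFilter hkcont.continuousAt
  have hHcont : Continuous H := continuous_iff_continuousAt.2 fun z => (hHd z).continuousAt
  have hHmono : StrictMono H := strictMono_of_deriv_pos fun z => by
    rw [(hHd z).deriv]; exact inv_pos.2 (hkpos z)
  have hH0 : H 0 = 0 := by simp [hH]
  have hH1 : H 1 = 1 := by
    refine Eq.trans (intervalIntegral.integral_congr fun z hz => ?_) h
    rw [Set.uIcc_of_le zero_le_one] at hz
    simp only [hk, hpid z hz]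
  have hgrow : Monotone fun z => H z - (c + 1)⁻¹ * z := by
    have hd : ∀ z, HasDerivAt (fun z => H z - (c + 1)⁻¹ * z) (k z - (c + 1)⁻¹ * 1) z :=
      fun z => (hHd z).sub ((hasDerivAt_id z).const_mul _)
    refine monotone_of_deriv_nonneg (fun z => (hd z).differentiableAt) fun z => ?_
    rw [(hd z).deriv, mul_one, sub_nonneg]
    exact inv_anti₀ (hkpos z) (kertzDenom_le (hpm z).1)
  have hc1 : 0 < (c + 1)⁻¹ := by positivity
  have hsurj : Function.Surjective H := by
    refine hHcont.surjective ?_ ?_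
    · refine Filter.tendsto_atTop_mono' _ ?_ (Filter.tendsto_id.const_mul_atTop hc1)
      filter_upwards [Filter.eventually_ge_atTop 0] with z hz
      have := hgrow hz
      simp only [hH0, id] at this ⊢; linarith
    · refine Filter.tendsto_atBot_mono' _ ?_ (Filter.tendsto_id.const_mul_atBot hc1)
      filter_upwards [Filter.eventually_le_atBot 0] with z hz
      have := hgrow hz
      simp only [hH0, id] at this ⊢; linarith
  set e := hHmono.orderIsoOfSurjective H hsurj with he
  have heH : ∀ v, H (e.symm v) = v := fun v => e.apply_symm_apply v
  have he1 : e.symm 1 = 1 := hHmono.injective ((heH 1).trans hH1.symm)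
  have he0 : e.symm 0 = 0 := hHmono.injective ((heH 0).trans hH0.symm)
  have hmem : ∀ t ∈ Set.Icc (0 : ℝ) 1, e.symm (1 - t) ∈ Set.Icc (0 : ℝ) 1 := by
    intro t ht
    constructor
    · rw [← he0]; exact e.symm.monotone (by linarith [ht.2])
    · rw [← he1]; exact e.symm.monotone (by linarith [ht.1])
  refine ⟨fun t => e.symm (1 - t), by simpa using he1, by simpa using he0, hmem,
    fun t ht => ?_, fun t ht => ?_⟩
  · rw [← he0]; exact e.symm.strictMono (by linarith)
  · have hd : HasDerivAt e.symm (k (e.symm (1 - t)))⁻¹ (1 - t) :=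
      HasDerivAt.of_local_left_inverse e.symm.continuous.continuousAt (hHd _)
        (inv_pos.2 (hkpos _)).ne' (Filter.Eventually.of_forall heH)
    have h2 := hd.comp t ((hasDerivAt_id t).const_sub 1)
    refine h2.congr_deriv ?_
    simp only [hk, inv_inv, hpid _ (hmem t ht)]
    ring

lemma IsKertzBound.exists_solvesThresholdODE {β : ℝ} (h : IsKertzBound β) :
    ∃ y : ℝ → ℝ, SolvesThresholdODE β y := by
  obtain ⟨hβ, hβ1, hint⟩ := isKertzBound_iff.1 h
  have hc : 0 < β⁻¹ - 1 := sub_pos.2 ((one_lt_inv₀ hβ).2 hβ1)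
  obtain ⟨y, hy0, hy1, hmem, hpos, hder⟩ := exists_hasDerivAt_neg_kertzDenom hc hint
  have hcont : ContinuousOn y (Set.Icc 0 1) :=
    fun t ht => (hder t ht).continuousAt.continuousWithinAt
  set w : ℝ → ℝ := fun t => kertzDenom (β⁻¹ - 1) (y t) with hw
  have hwpos : ∀ t ∈ Set.Icc (0 : ℝ) 1, 0 < w t :=
    fun t ht => kertzDenom_pos hc (hmem t ht).1 (hmem t ht).2
  have hlogw : ContinuousOn (fun t => Real.log (w t)) (Set.Icc 0 1) :=
    ((continuous_kertzDenom _).comp_continuousOn hcont).log fun t ht => (hwpos t ht).ne'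
  have hlogd : ∀ t ∈ Set.Ioo (0 : ℝ) 1,
      HasDerivAt (fun t => Real.log (w t)) (Real.log (y t)) t := by
    intro t ht
    have htI := Set.Ioo_subset_Icc_self ht
    have h1 := ((hasDerivAt_kertzDenom (β⁻¹ - 1) (hpos t ht.2).ne').comp t (hder t htI)).log
      (hwpos t htI).ne'
    refine h1.congr_deriv ?_
    have := (hwpos t htI).ne'
    simp only [hw] at this
    simp only [Function.comp]
    rw [neg_mul_neg, mul_div_assoc, div_self this, mul_one]
  -- `log y` has constant sign and is the derivative of `log D(y)`, which is continuous up to the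
  -- end points.
  have hli : IntegrableOn (fun t => Real.log (y t)) (Set.Ioc 0 1) := by
    have := intervalIntegral.integrableOn_deriv_of_nonneg hlogw.neg
      (fun t ht => (hlogd t ht).neg) fun t ht => neg_nonneg.2
        (Real.log_nonpos (hpos t ht.2).le (hmem t (Set.Ioo_subset_Icc_self ht)).2)
    simpa using this.neg
  have hlii : IntervalIntegrable (fun t => Real.log (y t)) volume 0 1 :=
    (intervalIntegrable_iff_integrableOn_Ioc_of_le zero_le_one).2 hli
  refine ⟨y, hmem, hy0, hy1, hlii,
    fun t ht => (hder t ht).differentiableAt.differentiableWithinAt, fun t ht => ?_⟩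
  have hsub : Set.Icc 0 t ⊆ Set.Icc (0 : ℝ) 1 := Set.Icc_subset_Icc_right ht.2
  rw [intervalIntegral.integral_eq_sub_of_hasDerivAt_of_le ht.1 (hlogw.mono hsub)
      (fun s hs => hlogd s ⟨hs.1, hs.2.trans_le ht.2⟩)
      (hlii.mono_set (by rwa [Set.uIcc_of_le zero_le_one, Set.uIcc_of_le ht.1])),
    ((hder t ht).hasDerivWithinAt).derivWithin (uniqueDiffOn_Icc_zero_one t ht),
    Real.exp_sub, Real.exp_log (hwpos t ht), Real.exp_log (hwpos 0 (by simp))]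
  simp only [hw, hy0, kertzDenom_one, sub_add_cancel]
  field_simp

lemma isKertzBound_iff_exists_solvesThresholdODE (β : ℝ) :
    IsKertzBound β ↔ ∃ y : ℝ → ℝ, SolvesThresholdODE β y :=
  ⟨fun h => h.exists_solvesThresholdODE, fun ⟨_, h⟩ => h.isKertzBound⟩


/-! ### The distribution of the maximum -/

section MaxCDF

variable {Ω : Type*} [MeasurableSpace Ω] {P : Measure Ω} {n : ℕ} {X : Fin n → Ω → ℝ≥0}

lemma measureReal_forall_mem_eq_prod (hX : iIndepFun X P)
    {s : Set ℝ≥0} (hs : MeasurableSet s) :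
    P.real {ω | ∀ i, X i ω ∈ s} = ∏ i, P.real {ω | X i ω ∈ s} := by
  have h := hX.measure_inter_preimage_eq_mul Finset.univ (sets := fun _ => s) fun _ _ => hs
  have h2 : {ω | ∀ i, X i ω ∈ s} = ⋂ i ∈ (Finset.univ : Finset (Fin n)), X i ⁻¹' s := by
    ext; simp
  rw [measureReal_def, h2, h, ENNReal.toReal_prod]
  rfl

lemma maxCDF_eq_prod (hX : iIndepFun X P) (r : ℝ≥0) :
    maxCDF P X r = ∏ i, cdfNN P (X i) r :=
  measureReal_forall_mem_eq_prod hX measurableSet_Iic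

lemma maxCDF_lt_of_lt_maxCDFInv {v : ℝ} {r : ℝ≥0} (h : r < maxCDFInv P X v) :
    maxCDF P X r < v := by
  by_contra hr
  exact notMem_of_lt_csInf h (OrderBot.bddBelow _) (not_lt.1 hr)

/-- The probability that a variable passes the (positive part of the) threshold `r`. -/
def passProb (P : Measure Ω) (Y : Ω → ℝ≥0) (r : ℝ≥0) : ℝ := P.real {ω | 0 < Y ω ∧ r ≤ Y ω}

lemma passProb_nonneg (Y : Ω → ℝ≥0) (r : ℝ≥0) : 0 ≤ passProb P Y r := measureReal_nonneg

/-- `F < v` to the left of `F⁻¹(v)`, and continuity extends `F ≤ v` to that point. The maximum with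
`x` covers `F⁻¹(v) = 0`, which has no left neighbours and may carry an atom. -/
lemma maxCDF_max_maxCDFInv_le (hF : Continuous (maxCDF P X)) (v : ℝ) (x : ℝ≥0) :
    maxCDF P X (max (maxCDFInv P X v) x) ≤ max v (maxCDF P X x) := by
  rcases le_or_gt (maxCDFInv P X v) x with h | h
  · rw [max_eq_right h]; exact le_max_right _ _
  rw [max_eq_left h.le]
  refine le_max_of_le_left ?_
  have hne : (Set.Iio (maxCDFInv P X v)).Nonempty := ⟨x, h⟩
  have hcl : maxCDFInv P X v ∈ closure (Set.Iio (maxCDFInv P X v)) := by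
    rw [closure_Iio' hne]; exact Set.mem_Iic.2 le_rfl
  exact closure_minimal (t := {r | maxCDF P X r ≤ v})
    (fun r hr => (maxCDF_lt_of_lt_maxCDFInv hr).le) (isClosed_Iic.preimage hF) hcl

/-- Layer cake for the law restricted to the passing event. -/
lemma lintegral_pass_ge {Y : Ω → ℝ≥0} (hY : Measurable Y) (r : ℝ≥0) :
    ∫⁻ t in Set.Ioi (0 : ℝ), P {ω | max r t.toNNReal < Y ω} ≤
      ∫⁻ ω in {ω | 0 < Y ω ∧ r ≤ Y ω}, (Y ω : ℝ≥0∞) ∂P := by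
  have hms : MeasurableSet {ω | 0 < Y ω ∧ r ≤ Y ω} :=
    hY (measurableSet_Ioi.inter measurableSet_Ici)
  have h1 : ∫⁻ ω in {ω | 0 < Y ω ∧ r ≤ Y ω}, (Y ω : ℝ≥0∞) ∂P
      = ∫⁻ ω in {ω | 0 < Y ω ∧ r ≤ Y ω}, ENNReal.ofReal (Y ω : ℝ) ∂P := by
    simp only [ENNReal.ofReal_coe_nnreal]
  rw [h1, lintegral_eq_lintegral_meas_lt _ (f := fun ω => (Y ω : ℝ))
    (Filter.Eventually.of_forall fun ω => (Y ω).2)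
    hY.coe_nnreal_real.aemeasurable]
  refine setLIntegral_mono' measurableSet_Ioi fun t ht => ?_
  rw [Measure.restrict_apply' hms]
  refine measure_mono fun ω hω => ?_
  have hω' : max r t.toNNReal < Y ω := hω
  obtain ⟨h2, h3⟩ := max_lt_iff.1 hω'
  refine ⟨?_, (zero_le).trans_lt h2, h2.le⟩
  rwa [← NNReal.coe_lt_coe, Real.coe_toNNReal t (le_of_lt ht)] at h3

variable [IsProbabilityMeasure P]

lemma maxCDF_le_one (r : ℝ≥0) : maxCDF P X r ≤ 1 := measureReal_le_one

lemma one_sub_cdfNN {Y : Ω → ℝ≥0} (hY : Measurable Y) (r : ℝ≥0) :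
    1 - cdfNN P Y r = P.real {ω | r < Y ω} := by
  have h := probReal_compl_eq_one_sub (μ := P) (s := {ω | Y ω ≤ r})
    (measurableSet_le hY measurable_const)
  rw [cdfNN, ← h]
  congr 1
  ext; simp

lemma exists_le_maxCDF {v : ℝ} (hv : v < 1) :
    ∃ r, v ≤ maxCDF P X r := by
  have hmono : Monotone fun k : ℕ => {ω | ∀ i, X i ω ≤ (k : ℝ≥0)} := fun k l hkl ω hω i =>
    (hω i).trans (by exact_mod_cast hkl)
  have hU : ⋃ k : ℕ, {ω | ∀ i, X i ω ≤ (k : ℝ≥0)} = Set.univ := by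
    refine Set.eq_univ_of_forall fun ω => ?_
    obtain ⟨k, hk⟩ := exists_nat_ge (Finset.univ.sup fun i => X i ω)
    exact Set.mem_iUnion.2 ⟨k, fun i =>
      (Finset.le_sup (f := fun i => X i ω) (Finset.mem_univ i)).trans hk⟩
  have ht := tendsto_measure_iUnion_atTop (μ := P) hmono
  rw [hU, measure_univ] at ht
  have ht' := (ENNReal.tendsto_toReal ENNReal.one_ne_top).comp ht
  obtain ⟨k, hk⟩ := (ht'.eventually (lt_mem_nhds (by simpa using hv))).exists
  exact ⟨k, hk.le⟩

lemma le_maxCDF_maxCDFInv (hF : Continuous (maxCDF P X)) {v : ℝ}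
    (hv : v < 1) : v ≤ maxCDF P X (maxCDFInv P X v) :=
  (isClosed_Ici.preimage hF).csInf_mem (exists_le_maxCDF hv) (OrderBot.bddBelow _)

lemma monotoneOn_maxCDFInv :
    MonotoneOn (maxCDFInv P X) (Set.Iio 1) := fun _ _ _ hw hvw =>
  csInf_le_csInf (OrderBot.bddBelow _) (exists_le_maxCDF hw) fun _ hr => hvw.trans hr

lemma antitone_passProb (Y : Ω → ℝ≥0) : Antitone (passProb P Y) := fun _ _ h =>
  measureReal_mono fun _ hω => ⟨hω.1, h.trans hω.2⟩

lemma measureReal_pos_le {Y : Ω → ℝ≥0} (hY : Measurable Y) {ε : ℝ} (h : IsSmall P Y ε 0) :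
    P.real {ω | 0 < Y ω} ≤ ε := by
  have hanti : Antitone fun r : ℝ≥0 => {ω | r < Y ω} := fun _ _ h _ hω => h.trans_lt hω
  have hmono : Monotone fun k : ℕ => {ω | ((k : ℝ≥0) + 1)⁻¹ < Y ω} := fun k l hkl =>
    hanti (inv_anti₀ (by positivity) (by gcongr))
  have hU : ⋃ k : ℕ, {ω | ((k : ℝ≥0) + 1)⁻¹ < Y ω} = {ω | 0 < Y ω} := by
    ext ω
    simp only [Set.mem_iUnion, Set.mem_ofPred_eq]
    refine ⟨fun ⟨k, hk⟩ => (zero_le).trans_lt hk, fun hω => ?_⟩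
    obtain ⟨k, hk⟩ := exists_nat_one_div_lt (K := ℝ) (NNReal.coe_pos.2 hω)
    exact ⟨k, by rw [← NNReal.coe_lt_coe]; simpa using hk⟩
  have ht := tendsto_measure_iUnion_atTop (μ := P) hmono
  rw [hU] at ht
  refine le_of_tendsto ((ENNReal.tendsto_toReal (measure_ne_top _ _)).comp ht)
    (Filter.Eventually.of_forall fun k => ?_)
  have h1 := h ((k : ℝ≥0) + 1)⁻¹ (by positivity)
  rwa [one_sub_cdfNN hY] at h1

lemma passProb_le {Y : Ω → ℝ≥0} (hY : Measurable Y) {ε : ℝ} (h : IsSmall P Y ε 0) (r : ℝ≥0) :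
    passProb P Y r ≤ ε :=
  (measureReal_mono fun _ hω => hω.1).trans (measureReal_pos_le hY h)

lemma measureReal_lt_le {Y : Ω → ℝ≥0} (hY : Measurable Y) {ε : ℝ} (h : IsSmall P Y ε 0)
    (r : ℝ≥0) : P.real {ω | r < Y ω} ≤ ε := by
  have hsub : {ω | r < Y ω} ⊆ {ω | 0 < Y ω} := by
    intro ω (hω : r < Y ω)
    exact (lt_of_le_of_lt zero_le hω : 0 < Y ω)
  exact (measureReal_mono hsub).trans (measureReal_pos_le hY h)

/-- The product is the probability that no variable passes. For `r > 0` it is at least `F(x)` for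
every `x < r`, hence at least `F(r)` by continuity. For `r = 0` passing means being positive, so an
atom at `0` does no harm. -/
lemma le_prod_one_sub_passProb (hm : ∀ i, Measurable (X i)) (hX : iIndepFun X P)
    (hF : Continuous (maxCDF P X)) {v : ℝ} (hv : v < 1) :
    v ≤ ∏ i, (1 - passProb P (X i) (maxCDFInv P X v)) := by
  set r := maxCDFInv P X v with hr
  have hvr : v ≤ maxCDF P X r := le_maxCDF_maxCDFInv hF hv
  set s : Set ℝ≥0 := {x | 0 < x ∧ r ≤ x}ᶜ with hs
  have hsm : MeasurableSet s := (measurableSet_Ioi.inter measurableSet_Ici).compl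
  have hprod : ∏ i, (1 - passProb P (X i) r) = P.real {ω | ∀ i, X i ω ∈ s} := by
    rw [measureReal_forall_mem_eq_prod hX hsm]
    refine Finset.prod_congr rfl fun i _ => ?_
    exact (probReal_compl_eq_one_sub (μ := P) (s := {ω | 0 < X i ω ∧ r ≤ X i ω})
      (hm i (measurableSet_Ioi.inter measurableSet_Ici))).symm
  rw [hprod]
  refine hvr.trans ?_
  rcases eq_or_ne r 0 with h0 | h0
  · refine measureReal_mono fun ω hω i hi => ?_
    have := hω i
    rw [h0] at this
    exact absurd hi.1 (not_lt.2 this)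
  · have hpos : 0 < r := pos_iff_ne_zero.2 h0
    have hcl : r ∈ closure (Set.Iio r) := by
      rw [closure_Iio' (a := r) ⟨0, hpos⟩]; exact Set.mem_Iic.2 le_rfl
    refine closure_minimal (t := {x | maxCDF P X x ≤ P.real {ω | ∀ i, X i ω ∈ s}})
      (fun x hx => ?_) (isClosed_Iic.preimage hF) hcl
    exact measureReal_mono fun ω hω i hi => absurd (hi.2.trans (hω i)) (not_le.2 hx)

/-- Union bound for small events: the tail probabilities sum to almost `-log F`. -/
lemma neg_log_maxCDF_le (hm : ∀ i, Measurable (X i)) (hX : iIndepFun X P) {ε : ℝ} (hε : ε < 1)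
    (hs : ∀ i, IsSmall P (X i) ε 0) (r : ℝ≥0) :
    (1 - ε) * -Real.log (maxCDF P X r) ≤ ∑ i, P.real {ω | r < X i ω} := by
  have hb : ∀ i, 0 < cdfNN P (X i) r := fun i => by
    have h1 := measureReal_lt_le (hm i) (hs i) r
    rw [← one_sub_cdfNN (hm i)] at h1
    linarith
  rw [maxCDF_eq_prod hX, Real.log_prod fun i _ => (hb i).ne', ← Finset.sum_neg_distrib,
    Finset.mul_sum]
  refine Finset.sum_le_sum fun i _ => ?_
  have h1 := measureReal_lt_le (hm i) (hs i) r
  rw [← one_sub_cdfNN (hm i)] at h1 ⊢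
  -- This gives `-Fᵢ log Fᵢ ≤ 1 - Fᵢ`; smallness supplies `Fᵢ ≥ 1 - ε`.
  have hlog := Real.one_sub_inv_le_log_of_pos (hb i)
  have hle : cdfNN P (X i) r ≤ 1 := measureReal_le_one
  have h2 : -Real.log (cdfNN P (X i) r) ≤ (1 - cdfNN P (X i) r) / cdfNN P (X i) r := by
    rw [sub_div, div_self (hb i).ne', one_div]; linarith
  rw [le_div_iff₀ (hb i)] at h2
  have h3 := Real.log_nonpos (hb i).le hle
  nlinarith

lemma maxCDF_pos (hm : ∀ i, Measurable (X i)) (hX : iIndepFun X P) {ε : ℝ} (hε : ε < 1)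
    (hs : ∀ i, IsSmall P (X i) ε 0) (r : ℝ≥0) : 0 < maxCDF P X r := by
  rw [maxCDF_eq_prod hX]
  refine Finset.prod_pos fun i _ => ?_
  have h1 := measureReal_lt_le (hm i) (hs i) r
  rw [← one_sub_cdfNN (hm i)] at h1
  linarith

lemma MAX_eq_lintegral (hm : ∀ i, Measurable (X i)) :
    MAX P X = ∫⁻ t in Set.Ioi (0 : ℝ), ENNReal.ofReal (1 - maxCDF P X t.toNNReal) := by
  set M : Ω → ℝ≥0 := fun ω => Finset.univ.sup fun i => X i ω with hM
  have hMm : Measurable M := by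
    refine measurable_of_Iic fun a => ?_
    have : M ⁻¹' Set.Iic a = ⋂ i, X i ⁻¹' Set.Iic a := by ext; simp [hM]
    rw [this]
    exact MeasurableSet.iInter fun i => hm i measurableSet_Iic
  have h1 : MAX P X = ∫⁻ ω, ENNReal.ofReal (M ω : ℝ) ∂P := by
    refine lintegral_congr fun ω => ?_
    rw [ENNReal.ofReal_coe_nnreal, hM]
    simp only [ENNReal.coe_finset_sup, Finset.sup_univ_eq_iSup]
  rw [h1, lintegral_eq_lintegral_meas_lt P (f := fun ω => (M ω : ℝ))
    (Filter.Eventually.of_forall fun ω => (M ω).2)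
    hMm.coe_nnreal_real.aemeasurable]
  refine setLIntegral_congr_fun measurableSet_Ioi fun t ht => ?_
  have hset : {ω | ∀ i, X i ω ≤ t.toNNReal} = {ω | M ω ≤ t.toNNReal} := by
    ext ω; simp [hM]
  have := one_sub_cdfNN (P := P) hMm t.toNNReal
  simp only [cdfNN, maxCDF] at this ⊢
  rw [hset, this, ofReal_measureReal]
  congr 1
  ext ω
  simp only [Set.mem_ofPred_eq]
  rw [← NNReal.coe_lt_coe, Real.coe_toNNReal t (le_of_lt ht)]

end MaxCDF


/-! ### The reward of a time-based policy as an iterated integral -/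

/-- Conditionally on coordinate `i` the constraints on the other coordinates are independent. It is
applied to the event that no other box preempts box `i`. -/
lemma lintegral_pi_indicator_forall_ne {E : Type*} [MeasurableSpace E] {n : ℕ}
    (ν : Fin n → Measure E) [∀ i, IsProbabilityMeasure (ν i)] (i : Fin n) {g : E → ℝ≥0∞}
    (hg : Measurable g) {S : Set (E × E)} (hS : MeasurableSet S) :
    ∫⁻ w, {w : Fin n → E | ∀ j, j ≠ i → (w i, w j) ∈ S}.indicator (fun w => g (w i)) w
        ∂Measure.pi ν =
      ∫⁻ a, g a * ∏ j ∈ {i}ᶜ, ν j (Prod.mk a ⁻¹' S) ∂ν i := by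
  obtain _ | m := n
  · exact i.elim0
  have hmeas : Measurable fun w : Fin (m + 1) → E =>
      {w : Fin (m + 1) → E | ∀ j, j ≠ i → (w i, w j) ∈ S}.indicator (fun w => g (w i)) w := by
    refine (hg.comp (measurable_pi_apply i)).indicator ?_
    have : {w : Fin (m + 1) → E | ∀ j, j ≠ i → (w i, w j) ∈ S}
        = ⋂ j, ⋂ (_ : j ≠ i), (fun w => (w i, w j)) ⁻¹' S := by ext; simp
    rw [this]
    exact MeasurableSet.iInter fun j => MeasurableSet.iInter fun _ =>
      ((measurable_pi_apply i).prodMk (measurable_pi_apply j)) hS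
  have hmp := (measurePreserving_piFinSuccAbove ν i).symm
  rw [← hmp.lintegral_comp hmeas]
  refine (lintegral_prod _ (hmeas.comp hmp.measurable).aemeasurable).trans
    (lintegral_congr fun a => ?_)
  simp only [Function.comp]
  have hset : ∀ v : Fin m → E,
      {w : Fin (m + 1) → E | ∀ j, j ≠ i → (w i, w j) ∈ S}.indicator (fun w => g (w i))
        ((MeasurableEquiv.piFinSuccAbove (fun _ => E) i).symm (a, v))
      = g a * (Set.univ.pi fun _ : Fin m => Prod.mk a ⁻¹' S).indicator 1 v := by
    intro v
    have hv : (MeasurableEquiv.piFinSuccAbove (fun _ => E) i).symm (a, v) = i.insertNth a v := rfl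
    have hiff : (∀ j, j ≠ i → (a, (i.insertNth a v : Fin (m + 1) → E) j) ∈ S)
        ↔ v ∈ Set.univ.pi fun _ : Fin m => Prod.mk a ⁻¹' S := by
      rw [Fin.forall_iff_succAbove i]
      simp
    by_cases hvS : v ∈ Set.univ.pi fun _ : Fin m => Prod.mk a ⁻¹' S
    · rw [Set.indicator_of_mem hvS, hv, Set.indicator_of_mem]
      · simp
      · simpa using hiff.2 hvS
    · rw [Set.indicator_of_notMem hvS, hv, Set.indicator_of_notMem, mul_zero]
      intro h
      exact hvS (hiff.1 (by simpa using h))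
  simp only [hset]
  rw [lintegral_const_mul _ (measurable_one.indicator
      (MeasurableSet.univ_pi fun _ => measurable_prodMk_left hS)),
    lintegral_indicator_one (MeasurableSet.univ_pi fun _ => measurable_prodMk_left hS),
    Measure.pi_pi, ← Fin.image_succAbove_univ,
    Finset.prod_image fun _ _ _ _ h => Fin.succAbove_right_injective h]

/-- The triples of a value, an arrival time and a coin for which a box qualifies. -/
def qualifyingSet (r : ℝ → ℝ≥0) (q : ℝ) : Set (ℝ≥0 × unitInterval × unitInterval) :=
  {a | 0 < a.1 ∧ r a.2.1 ≤ a.1 ∧ (a.2.2 : ℝ) ≤ q}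

lemma measurableSet_qualifyingSet {r : ℝ → ℝ≥0}
    (hr : Measurable fun t : unitInterval => r t) (q : ℝ) :
    MeasurableSet (qualifyingSet r q) := by
  have hu : MeasurableSet {a : ℝ≥0 × unitInterval × unitInterval | (a.2.2 : ℝ) ≤ q} :=
    measurableSet_le (measurable_subtype_coe.comp (measurable_snd.comp measurable_snd))
      measurable_const
  exact (measurableSet_lt measurable_const measurable_fst).inter
    ((measurableSet_le (hr.comp (measurable_fst.comp measurable_snd)) measurable_fst).inter hu)

lemma volume_unitInterval_le {q : ℝ} (h0 : 0 ≤ q) (h1 : q ≤ 1) :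
    volume {u : unitInterval | (u : ℝ) ≤ q} = ENNReal.ofReal q :=
  unitInterval.volume_Iic (x := ⟨q, h0, h1⟩)

/-- The coin is independent of value and time, so it integrates to the factor `q`. -/
lemma lintegral_indicator_qualifyingSet (μ : Measure ℝ≥0) [IsProbabilityMeasure μ] {r : ℝ → ℝ≥0}
    (hr : Measurable fun t : unitInterval => r t) {q : ℝ} (h0 : 0 ≤ q) (h1 : q ≤ 1)
    {f : ℝ≥0 × unitInterval → ℝ≥0∞} (hf : Measurable f) :
    ∫⁻ a, (qualifyingSet r q).indicator (fun a => f (a.1, a.2.1)) a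
        ∂(μ.prod (volume.prod volume)) =
      ENNReal.ofReal q * ∫⁻ t : unitInterval, ∫⁻ x in {x | 0 < x ∧ r t ≤ x}, f (x, t) ∂μ := by
  have hmeas : Measurable ((qualifyingSet r q).indicator fun a => f (a.1, a.2.1)) :=
    (hf.comp (measurable_fst.prodMk (measurable_fst.comp measurable_snd))).indicator
      (measurableSet_qualifyingSet hr q)
  rw [lintegral_prod_symm _ hmeas.aemeasurable,
    lintegral_prod _ (hmeas.lintegral_prod_left').aemeasurable]
  have hms : ∀ t : unitInterval, MeasurableSet {x : ℝ≥0 | 0 < x ∧ r t ≤ x} := fun t =>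
    measurableSet_Ioi.inter measurableSet_Ici
  have huq : MeasurableSet {u : unitInterval | (u : ℝ) ≤ q} :=
    measurableSet_le measurable_subtype_coe measurable_const
  have hinner : ∀ t u : unitInterval,
      ∫⁻ x, (qualifyingSet r q).indicator (fun a => f (a.1, a.2.1)) (x, (t, u)) ∂μ =
        {u : unitInterval | (u : ℝ) ≤ q}.indicator
          (fun _ => ∫⁻ x in {x | 0 < x ∧ r t ≤ x}, f (x, t) ∂μ) u := by
    intro t u
    by_cases hu : (u : ℝ) ≤ q
    · rw [Set.indicator_of_mem (show u ∈ {u : unitInterval | (u : ℝ) ≤ q} from hu),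
        ← lintegral_indicator (hms t)]
      refine lintegral_congr fun x => ?_
      simp [qualifyingSet, Set.indicator, hu]
    · rw [Set.indicator_of_notMem (show u ∉ {u : unitInterval | (u : ℝ) ≤ q} from hu)]
      simp [qualifyingSet, Set.indicator, hu]
  simp only [hinner, lintegral_indicator_const huq, volume_unitInterval_le h0 h1]
  rw [lintegral_mul_const'' _ ?_, mul_comm]
  have hpass : MeasurableSet {p : unitInterval × ℝ≥0 | r p.1 ≤ p.2} :=
    measurableSet_le (hr.comp measurable_fst) measurable_snd
  have h2 : Measurable fun p : unitInterval × ℝ≥0 =>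
      {p : unitInterval × ℝ≥0 | 0 < p.2 ∧ r p.1 ≤ p.2}.indicator (fun p => f (p.2, p.1)) p :=
    (hf.comp measurable_swap).indicator ((measurableSet_lt measurable_const measurable_snd).inter
      hpass)
  refine Measurable.aemeasurable ?_
  convert h2.lintegral_prod_right' (ν := μ) using 2 with t
  rw [← lintegral_indicator (hms t)]
  rfl

/-- The pairs of an arrival time `s` and a box which does not qualify before `s`. -/
def lateSet (r : ℝ → ℝ≥0) (q : ℝ) :
    Set (unitInterval × (ℝ≥0 × unitInterval × unitInterval)) :=
  {p | p.2 ∈ qualifyingSet r q → p.1 < p.2.2.1}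

lemma measurableSet_lateSet {r : ℝ → ℝ≥0}
    (hr : Measurable fun t : unitInterval => r t) (q : ℝ) : MeasurableSet (lateSet r q) := by
  have h : lateSet r q = (Prod.snd ⁻¹' qualifyingSet r q)ᶜ ∪
      {p : unitInterval × (ℝ≥0 × unitInterval × unitInterval) | p.1 < p.2.2.1} := by
    ext p
    simp only [lateSet, Set.mem_ofPred_eq, Set.mem_union, Set.mem_compl_iff, Set.mem_preimage]
    tauto
  rw [h]
  exact (measurable_snd (measurableSet_qualifyingSet hr q)).compl.union
    (measurableSet_lt measurable_fst (measurable_fst.comp (measurable_snd.comp measurable_snd)))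

lemma measurable_indicator_qualifyingSet {r : ℝ → ℝ≥0}
    (hr : Measurable fun t : unitInterval => r t) (q : ℝ) :
    Measurable ((qualifyingSet r q).indicator
      fun a : ℝ≥0 × unitInterval × unitInterval => (a.1 : ℝ≥0∞)) :=
  measurable_fst.coe_nnreal_ennreal.indicator (measurableSet_qualifyingSet hr q)

lemma measurableSet_pair_lateSet {r : ℝ → ℝ≥0}
    (hr : Measurable fun t : unitInterval => r t) (q : ℝ) :
    MeasurableSet {p : (ℝ≥0 × unitInterval × unitInterval) ×
      (ℝ≥0 × unitInterval × unitInterval) | (p.1.2.1, p.2) ∈ lateSet r q} :=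
  (((measurable_fst.comp measurable_snd).comp measurable_fst).prodMk measurable_snd)
    (measurableSet_lateSet hr q)

lemma measurable_timeReward_summand {n : ℕ} {r : ℝ → ℝ≥0}
    (hr : Measurable fun t : unitInterval => r t) (q : ℝ) (i : Fin n) :
    Measurable fun w : Fin n → ℝ≥0 × unitInterval × unitInterval =>
      {w : Fin n → ℝ≥0 × unitInterval × unitInterval |
        ∀ j, j ≠ i → (w i, w j) ∈ {p : (ℝ≥0 × unitInterval × unitInterval) ×
          (ℝ≥0 × unitInterval × unitInterval) | (p.1.2.1, p.2) ∈ lateSet r q}}.indicator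
      (fun w => (qualifyingSet r q).indicator (fun a => (a.1 : ℝ≥0∞)) (w i)) w := by
  refine ((measurable_indicator_qualifyingSet hr q).comp (measurable_pi_apply i)).indicator ?_
  simp only [Set.ofPred_forall]
  exact MeasurableSet.iInter fun j => MeasurableSet.iInter fun _ =>
    ((measurable_pi_apply i).prodMk (measurable_pi_apply j)) (measurableSet_pair_lateSet hr q)

lemma timeReward_eq_sum_indicator (r : ℝ → ℝ≥0) (q : ℝ) (t u : Fin n → unitInterval)
    (x : Fin n → ℝ≥0) :
    timeReward r q t u x = ∑ i, {w : Fin n → ℝ≥0 × unitInterval × unitInterval |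
        ∀ j, j ≠ i → (w i, w j) ∈ {p : (ℝ≥0 × unitInterval × unitInterval) ×
          (ℝ≥0 × unitInterval × unitInterval) | (p.1.2.1, p.2) ∈ lateSet r q}}.indicator
      (fun w => (qualifyingSet r q).indicator (fun a => (a.1 : ℝ≥0∞)) (w i))
      (fun i => (x i, t i, u i)) := by
  refine Finset.sum_congr rfl fun i _ => ?_
  simp only [Set.indicator, Set.mem_ofPred_eq, lateSet, qualifyingSet, Qualifies]
  by_cases h1 : 0 < x i ∧ r (t i) ≤ x i ∧ (u i : ℝ) ≤ q
  · simp only [h1, true_and, and_self, if_true]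
  · simp only [h1, false_and, if_false, ite_self]

lemma measurable_timeReward {Ω : Type*} [MeasurableSpace Ω] {n : ℕ} {X : Fin n → Ω → ℝ≥0}
    (hm : ∀ i, Measurable (X i)) {r : ℝ → ℝ≥0}
    (hr : Measurable fun t : unitInterval => r t) (q : ℝ) :
    Measurable fun z : Ω × (Fin n → unitInterval) × (Fin n → unitInterval) =>
      timeReward r q z.2.1 z.2.2 (fun i => X i z.1) := by
  have hz : Measurable fun (z : Ω × (Fin n → unitInterval) × (Fin n → unitInterval)) i =>
      (X i z.1, z.2.1 i, z.2.2 i) := measurable_pi_lambda _ fun i =>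
    ((hm i).comp measurable_fst).prodMk
      (((measurable_pi_apply i).comp (measurable_fst.comp measurable_snd)).prodMk
        ((measurable_pi_apply i).comp (measurable_snd.comp measurable_snd)))
  simp only [timeReward_eq_sum_indicator]
  exact Finset.measurable_fun_sum _ fun i _ => (measurable_timeReward_summand hr q i).comp hz

section ALG

variable {Ω : Type*} [MeasurableSpace Ω] {P : Measure Ω} [IsProbabilityMeasure P] {n : ℕ}
  {X : Fin n → Ω → ℝ≥0}

lemma measurePreserving_zip (hm : ∀ i, Measurable (X i)) (hX : iIndepFun X P) :
    MeasurePreserving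
      (fun (z : Ω × (Fin n → unitInterval) × (Fin n → unitInterval)) i =>
        (X i z.1, z.2.1 i, z.2.2 i))
      (P.prod (volume.prod volume))
      (Measure.pi fun i => (P.map (X i)).prod (volume.prod volume)) := by
  have hp : ∀ i, IsProbabilityMeasure (P.map (X i)) := fun i =>
    Measure.isProbabilityMeasure_map (hm i).aemeasurable
  have h1 : MeasurePreserving (fun ω i => X i ω) P (Measure.pi fun i => P.map (X i)) :=
    ⟨measurable_pi_lambda _ hm, (iIndepFun_iff_map_fun_eq_pi_map fun i => (hm i).aemeasurable).1 hX⟩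
  have h2 := (measurePreserving_arrowProdEquivProdArrow unitInterval unitInterval (Fin n)
    (fun _ => volume) (fun _ => volume)).symm
  have h3 := (measurePreserving_arrowProdEquivProdArrow ℝ≥0 (unitInterval × unitInterval) (Fin n)
    (fun i => P.map (X i)) (fun _ => volume.prod volume)).symm
  exact h3.comp (h1.prod h2)

lemma ALG_eq_sum (hm : ∀ i, Measurable (X i)) (hX : iIndepFun X P) {r : ℝ → ℝ≥0}
    (hr : Measurable fun t : unitInterval => r t) {q : ℝ} (h0 : 0 ≤ q) (h1 : q ≤ 1) :
    ALG P X r q = ∑ i, ENNReal.ofReal q * ∫⁻ s : unitInterval,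
      (∫⁻ ω in {ω | 0 < X i ω ∧ r s ≤ X i ω}, (X i ω : ℝ≥0∞) ∂P) *
      ∏ j ∈ {i}ᶜ, ((P.map (X j)).prod (volume.prod volume)) (Prod.mk s ⁻¹' lateSet r q) := by
  have hp : ∀ i, IsProbabilityMeasure (P.map (X i)) := fun i =>
    Measure.isProbabilityMeasure_map (hm i).aemeasurable
  set ν : Fin n → Measure (ℝ≥0 × unitInterval × unitInterval) :=
    fun i => (P.map (X i)).prod (volume.prod volume) with hν
  simp only [ALG, timeReward_eq_sum_indicator]
  rw [(measurePreserving_zip hm hX).lintegral_comp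
    (Finset.measurable_fun_sum Finset.univ fun i _ => measurable_timeReward_summand hr q i),
    lintegral_finsetSum _ fun i _ => measurable_timeReward_summand hr q i]
  refine Finset.sum_congr rfl fun i _ => ?_
  rw [lintegral_pi_indicator_forall_ne ν i (measurable_indicator_qualifyingSet hr q)
    (measurableSet_pair_lateSet hr q)]
  have hprod : Measurable fun s : unitInterval =>
      ∏ j ∈ {i}ᶜ, ν j (Prod.mk s ⁻¹' lateSet r q) :=
    Finset.measurable_prod _ fun j _ =>
      measurable_measure_prodMk_left (measurableSet_lateSet hr q)
  have hf : Measurable fun p : ℝ≥0 × unitInterval =>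
      (p.1 : ℝ≥0∞) * ∏ j ∈ {i}ᶜ, ν j (Prod.mk p.2 ⁻¹' lateSet r q) :=
    measurable_fst.coe_nnreal_ennreal.mul (hprod.comp measurable_snd)
  have h2 := lintegral_indicator_qualifyingSet (P.map (X i)) hr h0 h1 hf
  refine Eq.trans (lintegral_congr fun a => ?_) (h2.trans ?_)
  · by_cases ha : a ∈ qualifyingSet r q
    · simp only [Set.indicator_of_mem ha]
      rfl
    · simp only [Set.indicator_of_notMem ha, zero_mul]
  · congr 1
    refine lintegral_congr fun s => ?_
    simp only
    have hms : MeasurableSet {x : ℝ≥0 | 0 < x ∧ r s ≤ x} :=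
      measurableSet_Ioi.inter measurableSet_Ici
    rw [lintegral_mul_const _ measurable_coe_nnreal_ennreal, setLIntegral_map hms
      measurable_coe_nnreal_ennreal (hm i)]
    rfl

end ALG


/-! ### The lower bound on the reward of the time-based policy -/

lemma setIntegral_unitInterval_Iic {E : Type*} [NormedAddCommGroup E] [NormedSpace ℝ E]
    (f : ℝ → E) (s : unitInterval) :
    ∫ t in Set.Iic s, f t = ∫ t in (0 : ℝ)..s, f t := by
  have hset : (Subtype.val ⁻¹' Set.Iic (s : ℝ) : Set unitInterval) = Set.Iic s := rfl
  have h := unitInterval.measurePreserving_coe.setIntegral_preimage_emb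
    unitInterval.measurableEmbedding_coe f (Set.Iic (s : ℝ))
  rw [hset, Measure.restrict_restrict measurableSet_Iic] at h
  have h2 : Set.Iic (s : ℝ) ∩ unitInterval = Set.Icc 0 (s : ℝ) := by
    ext x
    simp only [Set.mem_inter_iff, Set.mem_Iic, Set.mem_Icc]
    exact ⟨fun h => ⟨h.2.1, h.1⟩, fun h => ⟨h.2, h.1, h.2.trans s.2.2⟩⟩
  rw [h, h2, integral_Icc_eq_integral_Ioc, intervalIntegral.integral_of_le s.2.1]

lemma integrable_unitInterval {f : ℝ → ℝ} (hf : IntervalIntegrable f volume 0 1) :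
    Integrable fun t : unitInterval => f t := by
  have h1 : IntegrableOn f (Set.Icc 0 1) :=
    (integrableOn_Icc_iff_integrableOn_Ioc).2
      ((intervalIntegrable_iff_integrableOn_Ioc_of_le zero_le_one).1 hf)
  exact (unitInterval.measurePreserving_coe.integrable_comp_emb
    unitInterval.measurableEmbedding_coe).2 h1

/-- The reason for thinning by `(1 - ε)²`: since `exp (-A) ≤ 1 / (1 + A)`, it suffices that `(1 -
ε)² (1 + A) ≤ 1`, which holds for `A ≤ ε`. -/
lemma exp_neg_le_one_sub_mul {ε A : ℝ} (h0 : 0 ≤ A) (h1 : A ≤ ε) (h2 : ε ≤ 1) :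
    Real.exp (-A) ≤ 1 - (1 - ε) ^ 2 * A := by
  have h3 : (1 + A) * Real.exp (-A) ≤ 1 := by
    have := Real.add_one_le_exp A
    calc (1 + A) * Real.exp (-A) ≤ Real.exp A * Real.exp (-A) := by gcongr; linarith
      _ = 1 := by rw [← Real.exp_add]; simp
  have h5 : (1 - ε) ^ 2 * (1 + A) ≤ 1 := by 
    nlinarith [sq_nonneg (1 - ε), mul_nonneg (h0.trans h1) (sub_nonneg.2 h2)]
  have h4 : 1 ≤ (1 - (1 - ε) ^ 2 * A) * (1 + A) := by nlinarith
  have h6 : 0 < 1 + A := by linarith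
  nlinarith [mul_comm (1 + A) (Real.exp (-A))]

section LowerBound

variable {Ω : Type*} [MeasurableSpace Ω] {P : Measure Ω} [IsProbabilityMeasure P]

lemma integrable_passProb (Y : Ω → ℝ≥0) {r : ℝ → ℝ≥0}
    (hr : Measurable fun t : unitInterval => r t) :
    Integrable fun t : unitInterval => passProb P Y (r t) :=
  Integrable.of_bound ((antitone_passProb Y).measurable.comp hr).aestronglyMeasurable 1
    (Filter.Eventually.of_forall fun t => by
      rw [Real.norm_of_nonneg (passProb_nonneg Y _)]; exact measureReal_le_one)

/-- The complementary event, qualifying no later than `s`, has probability exactly `q A`, where `A ≤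
ε` is the integrated passing probability. -/
lemma measure_lateSet_ge {Y : Ω → ℝ≥0} (hY : Measurable Y) {r : ℝ → ℝ≥0}
    (hr : Measurable fun t : unitInterval => r t) {ε : ℝ} (hε0 : 0 ≤ ε) (hε1 : ε ≤ 1)
    (hs : IsSmall P Y ε 0) (s : unitInterval) :
    ENNReal.ofReal (Real.exp (-∫ t in Set.Iic s, passProb P Y (r t))) ≤
      ((P.map Y).prod (volume.prod volume)) (Prod.mk s ⁻¹' lateSet r ((1 - ε) ^ 2)) := by
  have hp : IsProbabilityMeasure (P.map Y) := Measure.isProbabilityMeasure_map hY.aemeasurable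
  set q : ℝ := (1 - ε) ^ 2 with hq
  have hq0 : 0 ≤ q := sq_nonneg _
  have hq1 : q ≤ 1 := by rw [hq]; nlinarith
  set A : ℝ := ∫ t in Set.Iic s, passProb P Y (r t) with hA
  have hA0 : 0 ≤ A := integral_nonneg fun t => passProb_nonneg Y _
  have hAε : A ≤ ε := by
    have h1 : A ≤ ∫ _ in Set.Iic s, ε := integral_mono (integrable_passProb Y hr).integrableOn
      (integrable_const _) fun t => passProb_le hY hs _
    refine h1.trans ?_
    rw [setIntegral_const, smul_eq_mul]
    exact mul_le_of_le_one_left hε0 measureReal_le_one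
  have hms := measurable_prodMk_left (x := s) (measurableSet_lateSet hr q)
  have hf : Measurable ({p : ℝ≥0 × unitInterval | p.2 ≤ s}.indicator fun _ => (1 : ℝ≥0∞)) :=
    measurable_const.indicator (measurableSet_le measurable_snd measurable_const)
  have hcompl : ((P.map Y).prod (volume.prod volume)) (Prod.mk s ⁻¹' lateSet r q)ᶜ
      = ENNReal.ofReal (q * A) := by
    rw [← lintegral_indicator_one hms.compl]
    refine Eq.trans (lintegral_congr fun a => ?_)
      ((lintegral_indicator_qualifyingSet (P.map Y) hr hq0 hq1 hf).trans ?_)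
    · by_cases h1 : a ∈ qualifyingSet r q <;> by_cases h2 : s < a.2.1 <;>
        simp [lateSet, Set.indicator, h1, h2]
    · rw [ENNReal.ofReal_mul hq0, hA, ofReal_integral_eq_lintegral_ofReal
        (integrable_passProb Y hr).integrableOn
        (Filter.Eventually.of_forall fun t => passProb_nonneg Y _),
        ← lintegral_indicator measurableSet_Iic]
      congr 1
      refine lintegral_congr fun t => ?_
      have hpass : MeasurableSet {x : ℝ≥0 | 0 < x ∧ r t ≤ x} :=
        measurableSet_Ioi.inter measurableSet_Ici
      by_cases ht : t ≤ s
      · simp only [Set.indicator, Set.mem_ofPred_eq, ht, if_true, Set.mem_Iic, lintegral_const,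
          one_mul, Measure.restrict_apply_univ]
        rw [Measure.map_apply hY hpass, passProb, ofReal_measureReal]
        rfl
      · simp [Set.indicator, ht]
  have h1 := prob_compl_eq_one_sub (μ := (P.map Y).prod (volume.prod volume)) hms.compl
  rw [compl_compl, hcompl, ← ENNReal.ofReal_one, ← ENNReal.ofReal_sub _ (by positivity)] at h1
  rw [h1]
  exact ENNReal.ofReal_le_ofReal (exp_neg_le_one_sub_mul hA0 hAε hε1)

variable {n : ℕ} {X : Fin n → Ω → ℝ≥0}

lemma ALG_ge (hm : ∀ i, Measurable (X i)) (hX : iIndepFun X P) {r : ℝ → ℝ≥0}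
    (hr : Measurable fun t : unitInterval => r t) {ε : ℝ} (hε0 : 0 ≤ ε) (hε1 : ε ≤ 1)
    (hs : ∀ i, IsSmall P (X i) ε 0) :
    ∫⁻ s : unitInterval, ENNReal.ofReal ((1 - ε) ^ 2) *
        (∑ i, ∫⁻ ω in {ω | 0 < X i ω ∧ r s ≤ X i ω}, (X i ω : ℝ≥0∞) ∂P) *
        ENNReal.ofReal (Real.exp (-∑ j, ∫ t in Set.Iic s, passProb P (X j) (r t)))
      ≤ ALG P X r ((1 - ε) ^ 2) := by
  have hq0 : 0 ≤ (1 - ε) ^ 2 := sq_nonneg _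
  have hq1 : (1 - ε) ^ 2 ≤ 1 := by nlinarith
  have hp : ∀ i, IsProbabilityMeasure (P.map (X i)) := fun i =>
    Measure.isProbabilityMeasure_map (hm i).aemeasurable
  rw [ALG_eq_sum hm hX hr hq0 hq1, ← Finset.mul_sum]
  simp only [mul_assoc]
  rw [lintegral_const_mul' _ _ ENNReal.ofReal_ne_top]
  rw [← lintegral_finsetSum]
  swap
  · intro i _
    refine Measurable.mul ?_ (Finset.measurable_prod _ fun j _ =>
      measurable_measure_prodMk_left (measurableSet_lateSet hr _))
    have hanti : Antitone fun ρ : ℝ≥0 =>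
        ∫⁻ ω in {ω | 0 < X i ω ∧ ρ ≤ X i ω}, (X i ω : ℝ≥0∞) ∂P := fun _ _ h =>
      lintegral_mono_set fun _ hω => ⟨hω.1, h.trans hω.2⟩
    exact hanti.measurable.comp hr
  refine mul_le_mul_right (lintegral_mono fun s => ?_) _
  rw [Finset.sum_mul]
  refine Finset.sum_le_sum fun i _ => mul_le_mul_right ?_ _
  rw [← Finset.sum_neg_distrib, Real.exp_sum,
    ENNReal.ofReal_prod_of_nonneg fun j _ => (Real.exp_pos _).le]
  calc ∏ j, ENNReal.ofReal (Real.exp (-∫ t in Set.Iic s, passProb P (X j) (r t)))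
      ≤ ∏ j, ((P.map (X j)).prod (volume.prod volume))
          (Prod.mk s ⁻¹' lateSet r ((1 - ε) ^ 2)) :=
        Finset.prod_le_prod' fun j _ => measure_lateSet_ge (hm j) hr hε0 hε1 (hs j) s
    -- Including box `i` itself only lowers the product and makes the bound independent of `i`.
    _ ≤ _ := Finset.prod_le_prod_of_subset_of_le_one' (Finset.subset_univ _)
        fun j _ _ => prob_le_one

end LowerBound


/-! ### The logarithmic identity behind the constant `β`, and the bound on `ALG` -/

lemma integral_neg_log_max {v : ℝ} (h0 : 0 < v) (h1 : v ≤ 1) :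
    ∫ z in (0 : ℝ)..1, -Real.log (max z v) = 1 - v := by
  have hcont : Continuous fun z => -Real.log (max z v) :=
    ((continuous_id.max continuous_const).log fun z => (lt_max_of_lt_right h0).ne').neg
  rw [← intervalIntegral.integral_add_adjacent_intervals
    (hcont.intervalIntegrable 0 v) (hcont.intervalIntegrable v 1)]
  have e1 : ∫ z in (0 : ℝ)..v, -Real.log (max z v) = ∫ _ in (0 : ℝ)..v, -Real.log v := by
    refine intervalIntegral.integral_congr fun z hz => ?_
    rw [Set.uIcc_of_le h0.le] at hz
    simp only [max_eq_right hz.2]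
  have e2 : ∫ z in v..1, -Real.log (max z v) = ∫ z in v..1, -Real.log z := by
    refine intervalIntegral.integral_congr fun z hz => ?_
    rw [Set.uIcc_of_le h1] at hz
    simp only [max_eq_left hz.1]
  rw [e1, e2, intervalIntegral.integral_neg, intervalIntegral.integral_neg, integral_log,
    intervalIntegral.integral_const]
  simp only [smul_eq_mul, Real.log_one]
  ring

lemma SolvesThresholdODE.integral_neg_log_max_mul {β : ℝ} {y : ℝ → ℝ}
    (h : SolvesThresholdODE β y) {v : ℝ} (h0 : 0 < v) (h1 : v ≤ 1) :
    ∫ t in (0 : ℝ)..1, -Real.log (max (y t) v) * expIntegralLog y t = β * (1 - v) := by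
  have hcont : Continuous fun z => -Real.log (max z v) :=
    ((continuous_id.max continuous_const).log fun z => (lt_max_of_lt_right h0).ne').neg
  rw [h.integral_comp_mul_expIntegralLog (g := fun z => -Real.log (max z v)) hcont.continuousOn,
    integral_neg_log_max h0 h1]

section LowerBound

variable {Ω : Type*} [MeasurableSpace Ω] {P : Measure Ω} [IsProbabilityMeasure P] {n : ℕ}
  {X : Fin n → Ω → ℝ≥0} {β : ℝ} {y : ℝ → ℝ}

lemma SolvesThresholdODE.lt_one (h : SolvesThresholdODE β y) {t : ℝ} (h0 : 0 < t) (h1 : t ≤ 1) :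
    y t < 1 := by
  have := h.strictAntiOn (by simp) ⟨h0.le, h1⟩ h0
  rwa [h.y_zero] at this

lemma SolvesThresholdODE.measurable_threshold (h : SolvesThresholdODE β y) :
    Measurable fun t : unitInterval => maxCDFInv P X (y t) := by
  -- Time `0` is split off: `y 0 = 1`, and `F⁻¹(1)` may be the infimum of an empty set, which
  -- defaults to `0`. Elsewhere the threshold is antitone.
  refine measurable_of_restrict_of_restrict_compl (measurableSet_singleton 0)
    Subsingleton.measurable (Antitone.measurable fun t s hts => ?_)
  have h0 : ∀ t : ({0}ᶜ : Set unitInterval), (0 : ℝ) < (t : unitInterval) := fun t =>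
    unitInterval.pos_iff_ne_zero.2 t.2
  exact monotoneOn_maxCDFInv (h.lt_one (h0 s) (s : unitInterval).2.2)
    (h.lt_one (h0 t) (t : unitInterval).2.2)
    (h.strictAntiOn.antitoneOn (t : unitInterval).2 (s : unitInterval).2 hts)

lemma SolvesThresholdODE.expIntegralLog_le (h : SolvesThresholdODE β y)
    (hm : ∀ i, Measurable (X i)) (hX : iIndepFun X P) (hF : Continuous (maxCDF P X)) {ε : ℝ}
    (hε : ε < 1) (hs : ∀ i, IsSmall P (X i) ε 0) (s : unitInterval) :
    expIntegralLog y s ≤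
      Real.exp (-∑ j, ∫ t in Set.Iic s, passProb P (X j) (maxCDFInv P X (y t))) := by
  have hr : Measurable fun t : unitInterval => maxCDFInv P X (y t) := h.measurable_threshold
  have hint : ∀ j, Integrable fun t : unitInterval => passProb P (X j) (maxCDFInv P X (y t)) :=
    fun j => integrable_passProb (X j) (r := fun t => maxCDFInv P X (y t)) hr
  refine Real.exp_le_exp.2 ?_
  rw [← setIntegral_unitInterval_Iic (fun t => Real.log (y t)),
    ← integral_finsetSum _ fun j _ => (hint j).integrableOn, ← integral_neg]
  refine integral_mono_ae (integrable_unitInterval h.log_integrable).integrableOn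
    (integrable_finsetSum _ fun j _ => (hint j)).integrableOn.neg (ae_restrict_of_ae ?_)
  -- Both end points are discarded: at `0` the threshold may be a default value, and at `1` so is
  -- `Real.log 0 = 0`.
  filter_upwards [compl_mem_ae_iff.2 (measure_singleton (0 : unitInterval)),
    compl_mem_ae_iff.2 (measure_singleton (1 : unitInterval))] with t ht0 ht1
  have h0 : (0 : ℝ) < t := unitInterval.pos_iff_ne_zero.2 ht0
  have h1 : (t : ℝ) < 1 := unitInterval.lt_one_iff_ne_one.2 ht1
  have hb : ∀ j, 0 < 1 - passProb P (X j) (maxCDFInv P X (y t)) := fun j => by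
    linarith [passProb_le (hm j) (hs j) (maxCDFInv P X (y t))]
  have hle := Real.log_le_log (h.pos_of_lt_one h0.le h1)
    (le_prod_one_sub_passProb hm hX hF (h.lt_one h0 h1.le))
  rw [Real.log_prod fun j _ => (hb j).ne'] at hle
  refine hle.trans ?_
  rw [← Finset.sum_neg_distrib]
  exact Finset.sum_le_sum fun j _ => by linarith [Real.log_le_sub_one_of_pos (hb j)]

/-- The layer `x` of the final bound: the tail sum is at least `(1 - ε)` times `-log max (y(s),
F(x))`, whose integral against `E` is `β (1 - F(x))`. -/
lemma SolvesThresholdODE.lintegral_tail_ge (h : SolvesThresholdODE β y)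
    (hm : ∀ i, Measurable (X i)) (hX : iIndepFun X P) (hF : Continuous (maxCDF P X)) {ε : ℝ}
    (hε : ε < 1) (hs : ∀ i, IsSmall P (X i) ε 0) (x : ℝ≥0) :
    ENNReal.ofReal (β * (1 - ε)) * ENNReal.ofReal (1 - maxCDF P X x) ≤
      ∫⁻ s : unitInterval, (∑ i, P {ω | max (maxCDFInv P X (y s)) x < X i ω}) *
        ENNReal.ofReal (expIntegralLog y s) := by
  set v := maxCDF P X x with hv
  have hv0 : 0 < v := maxCDF_pos hm hX hε hs x
  have hv1 : v ≤ 1 := maxCDF_le_one x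
  have hε' : 0 < 1 - ε := sub_pos.2 hε
  have hcont : Continuous fun z => -Real.log (max z v) :=
    ((continuous_id.max continuous_const).log fun z => (lt_max_of_lt_right hv0).ne').neg
  have hii : IntervalIntegrable (fun t => -Real.log (max (y t) v) * expIntegralLog y t)
      volume 0 1 := ContinuousOn.intervalIntegrable_of_Icc zero_le_one
    ((hcont.comp_continuousOn h.continuousOn).mul h.continuousOn_expIntegralLog)
  have hlog : ∀ s : unitInterval, 0 ≤ -Real.log (max (y s) v) := fun s =>
    neg_nonneg.2 (Real.log_nonpos (lt_max_of_lt_right hv0).le (max_le (h.mem_Icc s s.2).2 hv1))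
  have hval : ∫ s : unitInterval, -Real.log (max (y s) v) * expIntegralLog y s
      = β * (1 - v) := by
    rw [← h.integral_neg_log_max_mul hv0 hv1]
    have h1 := setIntegral_unitInterval_Iic
      (fun t => -Real.log (max (y t) v) * expIntegralLog y t) 1
    have huniv : Set.Iic (1 : unitInterval) = Set.univ :=
      Set.eq_univ_of_forall fun t => unitInterval.le_one'
    rwa [huniv, setIntegral_univ] at h1
  rw [← ENNReal.ofReal_mul (mul_nonneg h.pos.le hε'.le),
    show β * (1 - ε) * (1 - v) = (1 - ε) * (β * (1 - v)) by ring, ← hval,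
    ENNReal.ofReal_mul hε'.le, ofReal_integral_eq_lintegral_ofReal (integrable_unitInterval hii)
      (Filter.Eventually.of_forall fun s => mul_nonneg (hlog s) (expIntegralLog_pos y s).le),
    ← lintegral_const_mul' _ _ ENNReal.ofReal_ne_top]
  refine lintegral_mono fun s => ?_
  rw [ENNReal.ofReal_mul (hlog s), ← mul_assoc, ← ENNReal.ofReal_mul hε'.le]
  refine mul_le_mul_left ?_ _
  have hsum : ∑ i, P {ω | max (maxCDFInv P X (y s)) x < X i ω}
      = ENNReal.ofReal (∑ i, P.real {ω | max (maxCDFInv P X (y s)) x < X i ω}) := by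
    rw [ENNReal.ofReal_sum_of_nonneg fun i _ => measureReal_nonneg]
    exact Finset.sum_congr rfl fun i _ => (ofReal_measureReal).symm
  rw [hsum]
  refine ENNReal.ofReal_le_ofReal (le_trans ?_ (neg_log_maxCDF_le hm hX hε hs _))
  refine mul_le_mul_of_nonneg_left (neg_le_neg ?_) hε'.le
  exact Real.log_le_log (maxCDF_pos hm hX hε hs _) (maxCDF_max_maxCDFInv_le hF (y s) x)

theorem SolvesThresholdODE.mul_MAX_le_ALG (h : SolvesThresholdODE β y)
    (hm : ∀ i, Measurable (X i)) (hX : iIndepFun X P) (hF : Continuous (maxCDF P X)) {ε : ℝ}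
    (hε0 : 0 ≤ ε) (hε : ε < 1) (hs : ∀ i, IsSmall P (X i) ε 0) :
    ENNReal.ofReal ((1 - ε) ^ 3 * β) * MAX P X ≤
      ALG P X (fun t => maxCDFInv P X (y t)) ((1 - ε) ^ 2) := by
  have hr : Measurable fun t : unitInterval => maxCDFInv P X (y t) := h.measurable_threshold
  have hALG := ALG_ge hm hX (r := fun t => maxCDFInv P X (y t)) hr hε0 hε.le hs
  have hq0 : 0 ≤ (1 - ε) ^ 2 := sq_nonneg _
  have hE : Measurable fun s : unitInterval => ENNReal.ofReal (expIntegralLog y s) :=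
    (continuousOn_iff_continuous_domRestrict.1
      h.continuousOn_expIntegralLog).measurable.ennreal_ofReal
  have htail : ∀ i, Measurable fun ρ : ℝ≥0 => P {ω | ρ < X i ω} := fun i =>
    Antitone.measurable fun _ _ hρ => measure_mono fun _ hω => hρ.trans_lt hω
  have htail2 : ∀ i, Measurable fun p : unitInterval × ℝ =>
      P {ω | max (maxCDFInv P X (y p.1)) p.2.toNNReal < X i ω} := fun i =>
    (htail i).comp ((hr.comp measurable_fst).max measurable_snd.real_toNNReal)
  have hsum : Measurable fun p : unitInterval × ℝ =>
      (∑ i, P {ω | max (maxCDFInv P X (y p.1)) p.2.toNNReal < X i ω}) *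
        ENNReal.ofReal (expIntegralLog y p.1) :=
    (Finset.measurable_fun_sum _ fun i _ => htail2 i).mul (hE.comp measurable_fst)
  calc ENNReal.ofReal ((1 - ε) ^ 3 * β) * MAX P X
      = ENNReal.ofReal ((1 - ε) ^ 2) * ∫⁻ t in Set.Ioi (0 : ℝ),
          ENNReal.ofReal (β * (1 - ε)) * ENNReal.ofReal (1 - maxCDF P X t.toNNReal) := by
        rw [lintegral_const_mul' _ _ ENNReal.ofReal_ne_top, ← MAX_eq_lintegral hm, ← mul_assoc,
          ← ENNReal.ofReal_mul hq0]
        congr 2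
        ring
    _ ≤ ENNReal.ofReal ((1 - ε) ^ 2) * ∫⁻ t in Set.Ioi (0 : ℝ), ∫⁻ s : unitInterval,
          (∑ i, P {ω | max (maxCDFInv P X (y s)) t.toNNReal < X i ω}) *
            ENNReal.ofReal (expIntegralLog y s) :=
        mul_le_mul_right (lintegral_mono fun t => h.lintegral_tail_ge hm hX hF hε hs _) _
    _ = ENNReal.ofReal ((1 - ε) ^ 2) * ∫⁻ s : unitInterval,
          (∑ i, ∫⁻ t in Set.Ioi (0 : ℝ), P {ω | max (maxCDFInv P X (y s)) t.toNNReal < X i ω}) *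
            ENNReal.ofReal (expIntegralLog y s) := by
        rw [← lintegral_lintegral_swap hsum.aemeasurable]
        congr 1
        refine lintegral_congr fun s => ?_
        have hts : ∀ i, Measurable fun t : ℝ =>
            P {ω | max (maxCDFInv P X (y s)) t.toNNReal < X i ω} := fun i =>
          (htail i).comp (measurable_const.max measurable_id.real_toNNReal)
        rw [lintegral_mul_const' _ _ ENNReal.ofReal_ne_top, lintegral_finsetSum _ fun i _ => hts i]
    _ ≤ ∫⁻ s : unitInterval, ENNReal.ofReal ((1 - ε) ^ 2) *
          (∑ i, ∫⁻ ω in {ω | 0 < X i ω ∧ maxCDFInv P X (y s) ≤ X i ω}, (X i ω : ℝ≥0∞) ∂P) *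
          ENNReal.ofReal (Real.exp
            (-∑ j, ∫ t in Set.Iic s, passProb P (X j) (maxCDFInv P X (y t)))) := by
        rw [← lintegral_const_mul' _ _ ENNReal.ofReal_ne_top]
        refine lintegral_mono fun s => ?_
        rw [mul_assoc]
        refine mul_le_mul_right (mul_le_mul' ?_ ?_) _
        · exact Finset.sum_le_sum fun i _ => lintegral_pass_ge (hm i) _
        · exact ENNReal.ofReal_le_ofReal (h.expIntegralLog_le hm hX hF hε hs s)
    _ ≤ ALG P X (fun t => maxCDFInv P X (y t)) ((1 - ε) ^ 2) := hALG

end LowerBound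


/-! ### Time-based policies are mixtures of online policies -/

/-- The online policy that pretends that the `k`-th box arrives at time `s k` and that the coin of
box `i` is `u i`. -/
def timePolicy {n : ℕ} (r : ℝ → ℝ≥0) (q : ℝ) (s u : Fin n → unitInterval) : Policy n where
  accept k := {h | 0 < (h ⟨k, le_refl k⟩).2 ∧ r (s k) ≤ (h ⟨k, le_refl k⟩).2 ∧
    (u (h ⟨k, le_refl k⟩).1 : ℝ) ≤ q}
  measurable_accept k := by
    have h1 : Measurable fun h : Set.Iic k → Fin n × ℝ≥0 => h ⟨k, le_refl k⟩ :=
      measurable_pi_apply _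
    have h2 : Measurable fun i : Fin n => (u i : ℝ) := measurable_of_countable _
    have h3 : MeasurableSet {a : Fin n × ℝ≥0 | 0 < a.2 ∧ r (s k) ≤ a.2 ∧ (u a.1 : ℝ) ≤ q} :=
      (measurableSet_lt measurable_const measurable_snd).inter
        ((measurableSet_le measurable_const measurable_snd).inter
          (measurableSet_le (h2.comp measurable_fst) measurable_const))
    exact h1 h3

/-- With sorted times `s`, box `σ k` arrives at `s k`. Equality can fail at ties: `timeReward` wants
a strictly first box, whereas the policy takes the first in the order `σ`. -/
lemma timeReward_le_reward_timePolicy {n : ℕ} (r : ℝ → ℝ≥0) (q : ℝ) {s : Fin n → unitInterval}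
    (hs : Monotone s) (u : Fin n → unitInterval) (σ : Equiv.Perm (Fin n)) (x : Fin n → ℝ≥0) :
    timeReward r q (s ∘ σ.symm) u x ≤ (timePolicy r q s u).reward σ x := by
  have hacc : ∀ k, history σ x k ∈ (timePolicy r q s u).accept k ↔
      Qualifies r q (s ∘ σ.symm) u x (σ k) := by
    intro k
    simp [timePolicy, history, Qualifies]
  rw [timeReward, Policy.reward, ← Equiv.sum_comp σ]
  refine Finset.sum_le_sum fun k _ => ?_
  split_ifs with h1 h2
  · exact le_rfl
  · refine absurd ⟨(hacc k).2 h1.1, fun j hj hacc' => ?_⟩ h2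
    have h3 := h1.2 (σ j) (fun h => hj.ne (σ.injective h)) ((hacc j).1 hacc')
    simp only [Function.comp, Equiv.symm_apply_apply] at h3
    exact absurd h3 (not_lt.2 (hs hj.le))
  · exact zero_le
  · exact le_rfl

section OPT

variable {Ω : Type*} [MeasurableSpace Ω] {P : Measure Ω} {n : ℕ} {X : Fin n → Ω → ℝ≥0}

lemma sum_lintegral_reward_le (p : Policy n) :
    ∑ σ : Equiv.Perm (Fin n), ∫⁻ ω, p.reward σ (fun i => X i ω) ∂P ≤
      (n.factorial : ℝ≥0∞) * OPT P X := by
  have h : p.value P X ≤ OPT P X := le_iSup (fun p : Policy n => p.value P X) p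
  rwa [Policy.value, ENNReal.div_le_iff' (by exact_mod_cast n.factorial_ne_zero)
    (ENNReal.natCast_ne_top _)] at h

lemma sum_lintegral_timeReward_le (r : ℝ → ℝ≥0) (q : ℝ) (t u : Fin n → unitInterval) :
    ∑ σ : Equiv.Perm (Fin n), ∫⁻ ω, timeReward r q (t ∘ σ.symm) u (fun i => X i ω) ∂P ≤
      (n.factorial : ℝ≥0∞) * OPT P X := by
  set τ := Tuple.sort t
  refine le_trans ?_ (sum_lintegral_reward_le (timePolicy r q (t ∘ τ) u))
  -- Reindexing by `σ τ⁻¹` absorbs the sorting, so a single policy serves all orders.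
  rw [← Equiv.sum_comp (Equiv.mulRight τ⁻¹)]
  refine Finset.sum_le_sum fun σ _ => lintegral_mono fun ω => ?_
  have h : t ∘ (Equiv.mulRight τ⁻¹ σ).symm = (t ∘ τ) ∘ σ.symm := by
    ext i
    simp only [Equiv.coe_mulRight, Equiv.Perm.mul_def, Equiv.symm_trans_apply, Function.comp]
    rfl
  rw [h]
  exact timeReward_le_reward_timePolicy r q (Tuple.monotone_sort t) u σ _

/-- Arrival times are exchangeable, so `ALG` is also the average over all permutations of the times;
for fixed times and coins that average is bounded by the value of an online policy. -/
theorem ALG_le_OPT [IsProbabilityMeasure P] (hm : ∀ i, Measurable (X i)) {r : ℝ → ℝ≥0}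
    (hr : Measurable fun t : unitInterval => r t) (q : ℝ) : ALG P X r q ≤ OPT P X := by
  have hf := measurable_timeReward hm hr q
  have hmp : ∀ σ : Equiv.Perm (Fin n), MeasurePreserving
      (fun z : Ω × (Fin n → unitInterval) × (Fin n → unitInterval) =>
        (z.1, z.2.1 ∘ σ.symm, z.2.2))
      (P.prod (volume.prod volume)) (P.prod (volume.prod volume)) := by
    intro σ
    have h1 : MeasurePreserving (fun t : Fin n → unitInterval => t ∘ σ.symm) := by
      have h2 : (fun t : Fin n → unitInterval => t ∘ σ.symm)
          = MeasurableEquiv.piCongrLeft (fun _ => unitInterval) σ := by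
        funext t i
        obtain ⟨j, rfl⟩ := σ.surjective i
        simp [MeasurableEquiv.coe_piCongrLeft, Equiv.piCongrLeft_apply_apply]
      rw [h2]
      exact volume_measurePreserving_piCongrLeft (fun _ => unitInterval) σ
    exact (MeasurePreserving.id P).prod (h1.prod (MeasurePreserving.id volume))
  have hfσ : ∀ σ : Equiv.Perm (Fin n), Measurable
      fun z : Ω × (Fin n → unitInterval) × (Fin n → unitInterval) =>
        timeReward r q (z.2.1 ∘ σ.symm) z.2.2 (fun i => X i z.1) := fun σ =>
    hf.comp (hmp σ).measurable
  have hALG : (n.factorial : ℝ≥0∞) * ALG P X r q = ∑ σ : Equiv.Perm (Fin n),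
      ∫⁻ z, timeReward r q (z.2.1 ∘ σ.symm) z.2.2 (fun i => X i z.1)
        ∂(P.prod (volume.prod volume)) := by
    have h1 : ∀ σ : Equiv.Perm (Fin n),
        ∫⁻ z, timeReward r q (z.2.1 ∘ σ.symm) z.2.2 (fun i => X i z.1)
          ∂(P.prod (volume.prod volume)) = ALG P X r q := fun σ => (hmp σ).lintegral_comp hf
    simp [h1, Fintype.card_perm]
  have hle : (n.factorial : ℝ≥0∞) * ALG P X r q ≤ (n.factorial : ℝ≥0∞) * OPT P X := by
    rw [hALG]
    calc ∑ σ : Equiv.Perm (Fin n),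
          ∫⁻ z, timeReward r q (z.2.1 ∘ σ.symm) z.2.2 (fun i => X i z.1)
            ∂(P.prod (volume.prod volume))
        = ∑ σ : Equiv.Perm (Fin n), ∫⁻ w : (Fin n → unitInterval) × (Fin n → unitInterval),
            ∫⁻ ω, timeReward r q (w.1 ∘ σ.symm) w.2 (fun i => X i ω) ∂P
            ∂(volume.prod volume) :=
          Finset.sum_congr rfl fun σ _ => lintegral_prod_symm _ (hfσ σ).aemeasurable
      _ = ∫⁻ w : (Fin n → unitInterval) × (Fin n → unitInterval),
            ∑ σ : Equiv.Perm (Fin n),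
              ∫⁻ ω, timeReward r q (w.1 ∘ σ.symm) w.2 (fun i => X i ω) ∂P
            ∂(volume.prod volume) :=
          (lintegral_finsetSum _ fun σ _ => (hfσ σ).lintegral_prod_left').symm
      _ ≤ ∫⁻ _ : (Fin n → unitInterval) × (Fin n → unitInterval),
            (n.factorial : ℝ≥0∞) * OPT P X ∂(volume.prod volume) :=
          lintegral_mono fun w => sum_lintegral_timeReward_le r q w.1 w.2
      _ = (n.factorial : ℝ≥0∞) * OPT P X := by simp
  exact (ENNReal.mul_le_mul_iff_right (by exact_mod_cast n.factorial_ne_zero)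
    (ENNReal.natCast_ne_top _)).1 hle

end OPT


/-! ### Smoothing the distributions -/

/-- The policy that applies `p` to the values multiplied by the factors `m`. -/
def Policy.rescale {n : ℕ} (p : Policy n) (m : Fin n → ℝ≥0) : Policy n where
  accept k := (fun h j => ((h j).1, (h j).2 * m (h j).1)) ⁻¹' p.accept k
  measurable_accept k := by
    have hm : Measurable m := measurable_of_countable m
    refine measurable_pi_lambda _ (fun j => ?_) (p.measurable_accept k)
    have hj : Measurable fun h : Set.Iic k → Fin n × ℝ≥0 => h j := measurable_pi_apply j
    exact hj.fst.prodMk (hj.snd.mul (hm.comp hj.fst))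

lemma Policy.reward_mul_le {n : ℕ} (p : Policy n) {m : Fin n → ℝ≥0} {c : ℝ≥0}
    (hm : ∀ i, m i ≤ c) (σ : Equiv.Perm (Fin n)) (x : Fin n → ℝ≥0) :
    p.reward σ (fun i => x i * m i) ≤ c * (p.rescale m).reward σ x := by
  have hiff : ∀ k, (p.rescale m).StopsAt σ x k ↔ p.StopsAt σ (fun i => x i * m i) k :=
    fun k => Iff.rfl
  rw [Policy.reward, Policy.reward, Finset.mul_sum]
  refine Finset.sum_le_sum fun k _ => ?_
  rw [hiff]
  split_ifs
  · rw [ENNReal.coe_mul, mul_comm]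
    exact mul_le_mul_left (ENNReal.coe_le_coe.2 (hm _)) _
  · exact zero_le

lemma Policy.measurable_reward {n : ℕ} (p : Policy n) (σ : Equiv.Perm (Fin n)) :
    Measurable (p.reward σ) := by
  have hh : ∀ k, MeasurableSet {x : Fin n → ℝ≥0 | history σ x k ∈ p.accept k} := fun k =>
    (measurable_pi_lambda (fun x : Fin n → ℝ≥0 => history σ x k) fun j =>
      measurable_const.prodMk (measurable_pi_apply _)) (p.measurable_accept k)
  refine Finset.measurable_fun_sum _ fun k _ => Measurable.ite ?_
    (measurable_pi_apply (σ k)).coe_nnreal_ennreal measurable_const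
  have hset : {x : Fin n → ℝ≥0 | p.StopsAt σ x k} =
      {x | history σ x k ∈ p.accept k} ∩ ⋂ j, ⋂ (_ : j < k), {x | history σ x j ∈ p.accept j}ᶜ := by
    ext x
    simp [Policy.StopsAt]
  rw [hset]
  exact (hh k).inter (MeasurableSet.iInter fun j => MeasurableSet.iInter fun _ => (hh j).compl)

section Smoothing

variable {Ω : Type*} [MeasurableSpace Ω] {P : Measure Ω} {n : ℕ} {X : Fin n → Ω → ℝ≥0}

/-- The random factor that makes the distributions continuous away from `0`. -/
def smoothingFactor (η : ℝ≥0) (v : unitInterval) : ℝ≥0 := 1 + η * Real.toNNReal v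

lemma measurable_smoothingFactor (η : ℝ≥0) : Measurable (smoothingFactor η) :=
  (measurable_subtype_coe.real_toNNReal.const_mul η).const_add 1

lemma one_le_smoothingFactor (η : ℝ≥0) (v : unitInterval) : 1 ≤ smoothingFactor η v :=
  le_self_add

lemma smoothingFactor_le (η : ℝ≥0) (v : unitInterval) : smoothingFactor η v ≤ 1 + η := by
  refine add_le_add_right (mul_le_of_le_one_right zero_le ?_) _
  exact Real.toNNReal_le_one.2 v.2.2

lemma smoothingFactor_injective {η : ℝ≥0} (hη : 0 < η) :
    Function.Injective (smoothingFactor η) := by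
  intro v w h
  have h1 := mul_left_cancel₀ hη.ne' (add_left_cancel h)
  exact Subtype.ext ((Real.toNNReal_eq_toNNReal_iff v.2.1 w.2.1).1 h1)

/-- The variables multiplied by independent random factors. -/
def smoothed (X : Fin n → Ω → ℝ≥0) (η : ℝ≥0) (i : Fin n) (z : Ω × (Fin n → unitInterval)) : ℝ≥0 :=
  X i z.1 * smoothingFactor η (z.2 i)

lemma measurable_smoothed (hm : ∀ i, Measurable (X i)) (η : ℝ≥0) (i : Fin n) :
    Measurable (smoothed X η i) :=
  ((hm i).comp measurable_fst).mul
    ((measurable_smoothingFactor η).comp ((measurable_pi_apply i).comp measurable_snd))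

lemma le_smoothed {S : Type*} (X : Fin n → S → ℝ≥0) (η : ℝ≥0) (i : Fin n)
    (z : S × (Fin n → unitInterval)) : X i z.1 ≤ smoothed X η i z :=
  le_mul_of_one_le_right zero_le (one_le_smoothingFactor η _)

lemma MAX_le_MAX_smoothed (hm : ∀ i, Measurable (X i)) (η : ℝ≥0) :
    MAX P X ≤ MAX (P.prod volume) (smoothed X η) := by
  have h := (measurePreserving_fst (μ := P)
    (ν := (volume : Measure (Fin n → unitInterval)))).lintegral_comp
      (Measurable.iSup fun i => (hm i).coe_nnreal_ennreal)
  rw [MAX, ← h]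
  exact lintegral_mono fun z => iSup_mono fun i => ENNReal.coe_le_coe.2 (le_smoothed X η i z)

variable [IsProbabilityMeasure P]

lemma iIndepFun_smoothed (hm : ∀ i, Measurable (X i)) (hX : iIndepFun X P) (η : ℝ≥0) :
    iIndepFun (smoothed X η) (P.prod volume) := by
  have hp : ∀ i, IsProbabilityMeasure (P.map (X i)) := fun i =>
    Measure.isProbabilityMeasure_map (hm i).aemeasurable
  have h1 : MeasurePreserving (fun ω i => X i ω) P (Measure.pi fun i => P.map (X i)) :=
    ⟨measurable_pi_lambda _ hm, (iIndepFun_iff_map_fun_eq_pi_map fun i => (hm i).aemeasurable).1 hX⟩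
  have h2 := (measurePreserving_arrowProdEquivProdArrow ℝ≥0 unitInterval (Fin n)
    (fun i => P.map (X i)) (fun _ => volume)).symm
  have h3 : MeasurePreserving (fun (z : Ω × (Fin n → unitInterval)) i => (X i z.1, z.2 i))
      (P.prod volume) (Measure.pi fun i => (P.map (X i)).prod volume) :=
    h2.comp (h1.prod (MeasurePreserving.id volume))
  have hpair : iIndepFun (fun i (z : Ω × (Fin n → unitInterval)) => (X i z.1, z.2 i))
      (P.prod volume) := by
    have hmeas : ∀ i, Measurable fun z : Ω × (Fin n → unitInterval) => (X i z.1, z.2 i) :=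
      fun i => ((hm i).comp measurable_fst).prodMk ((measurable_pi_apply i).comp measurable_snd)
    rw [iIndepFun_iff_map_fun_eq_pi_map fun i => (hmeas i).aemeasurable, h3.map_eq]
    congr 1
    funext i
    exact ((measurePreserving_eval (fun i => (P.map (X i)).prod volume) i).comp h3).map_eq.symm
  exact hpair.comp (fun _ a => a.1 * smoothingFactor η a.2) fun _ =>
    measurable_fst.mul ((measurable_smoothingFactor η).comp measurable_snd)

/-- Multiplicative smoothing fixes the value `0`, so the probability of being positive does not
grow. -/
lemma isSmall_smoothed (hm : ∀ i, Measurable (X i)) {ε : ℝ} {i : Fin n}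
    (hs : IsSmall P (X i) ε 0) (η : ℝ≥0) :
    IsSmall (P.prod volume) (smoothed X η i) ε 0 := by
  intro r _
  rw [one_sub_cdfNN (measurable_smoothed hm η i)]
  refine le_trans ?_ (measureReal_pos_le (hm i) hs)
  have hpos : MeasurableSet {ω | 0 < X i ω} := hm i measurableSet_Ioi
  have hfst := (measurePreserving_fst (μ := P)
    (ν := (volume : Measure (Fin n → unitInterval)))).measureReal_preimage hpos.nullMeasurableSet
  rw [← hfst]
  refine measureReal_mono fun z hz => ?_
  by_contra h0
  have h0 : X i z.1 = 0 := nonpos_iff_eq_zero.1 (not_lt.1 h0)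
  have hz : r < X i z.1 * smoothingFactor η (z.2 i) := hz
  rw [h0, zero_mul] at hz
  exact not_lt_zero hz

/-- For a given value of `X i`, at most one factor produces a given `r > 0`, so there are no
positive atoms. An atom at `0` is invisible on `ℝ≥0`, where `0` has no left neighbours. -/
lemma continuous_maxCDF_smoothed (hm : ∀ i, Measurable (X i)) {η : ℝ≥0} (hη : 0 < η) :
    Continuous (maxCDF (P.prod volume) (smoothed X η)) := by
  have hmeas : ∀ r : ℝ≥0, MeasurableSet {z | ∀ i, smoothed X η i z ≤ r} := fun r => by
    simp only [Set.ofPred_forall]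
    exact MeasurableSet.iInter fun i => measurable_smoothed hm η i measurableSet_Iic
  refine continuous_iff_continuousAt.2 fun r => ?_
  have hae : ∀ i, ∀ᵐ z ∂(P.prod volume), smoothed X η i z = r → r = 0 := by
    intro i
    rcases eq_or_ne r 0 with h0 | h0
    · exact Filter.Eventually.of_forall fun _ _ => h0
    have hnull : (P.prod volume) (smoothed X η i ⁻¹' {r}) = 0 := by
      rw [Measure.measure_prod_null (measurable_smoothed hm η i (measurableSet_singleton r))]
      refine Filter.Eventually.of_forall fun ω => ?_
      have hsub : {v : unitInterval | X i ω * smoothingFactor η v = r}.Subsingleton := by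
        intro v (hv : _ = r) w (hw : _ = r)
        have hX0 : X i ω ≠ 0 := fun h => h0 (by rw [← hv, h, zero_mul])
        exact smoothingFactor_injective hη (mul_left_cancel₀ hX0 (hv.trans hw.symm))
      have h1 := (measurePreserving_eval
        (fun _ : Fin n => (volume : Measure unitInterval)) i).measure_preimage
        hsub.measurableSet.nullMeasurableSet
      rw [hsub.measure_zero] at h1
      exact h1
    filter_upwards [compl_mem_ae_iff.2 hnull] with z hz h
    exact absurd h hz
  have hlim := tendsto_measure_of_ae_tendsto_indicator_of_isFiniteMeasure (nhds r) (hmeas r)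
    (μ := P.prod volume) (As := fun ρ => {z | ∀ i, smoothed X η i z ≤ ρ}) hmeas (by
      filter_upwards [ae_all_iff.2 hae] with z hz
      have h1 : ∀ i, ∀ᶠ ρ in nhds r, smoothed X η i z ≤ ρ ↔ smoothed X η i z ≤ r := by
        intro i
        rcases lt_trichotomy (smoothed X η i z) r with h | h | h
        · filter_upwards [lt_mem_nhds h] with ρ hρ
          exact iff_of_true hρ.le h.le
        · have h0 := h.trans (hz i h)
          exact Filter.Eventually.of_forall fun ρ => by simp [h0]
        · filter_upwards [gt_mem_nhds h] with ρ hρ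
          exact iff_of_false (not_le.2 hρ) (not_le.2 h)
      filter_upwards [Filter.eventually_all.2 h1] with ρ hρ
      exact forall_congr' hρ)
  exact (ENNReal.tendsto_toReal (measure_ne_top _ _)).comp hlim

/-- Once the factors are fixed, a policy for the smoothed variables becomes one for the original
variables that stops at the same boxes; the rewards differ by a factor of at most `1 + η`. -/
lemma OPT_smoothed_le (hm : ∀ i, Measurable (X i)) (η : ℝ≥0) :
    OPT (P.prod volume) (smoothed X η) ≤ ((1 + η : ℝ≥0) : ℝ≥0∞) * OPT P X := by
  refine iSup_le fun p => ?_
  rw [Policy.value]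
  refine ENNReal.div_le_of_le_mul' ?_
  have hr : ∀ σ, Measurable fun z : Ω × (Fin n → unitInterval) =>
      p.reward σ (fun i => smoothed X η i z) := fun σ =>
    (p.measurable_reward σ).comp (measurable_pi_lambda _ fun i => measurable_smoothed hm η i)
  calc ∑ σ : Equiv.Perm (Fin n),
        ∫⁻ z, p.reward σ (fun i => smoothed X η i z) ∂(P.prod volume)
      = ∫⁻ v : Fin n → unitInterval, ∑ σ : Equiv.Perm (Fin n),
          ∫⁻ ω, p.reward σ (fun i => smoothed X η i (ω, v)) ∂P := by
        rw [lintegral_finsetSum _ fun σ _ => (hr σ).lintegral_prod_left']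
        exact Finset.sum_congr rfl fun σ _ => lintegral_prod_symm _ (hr σ).aemeasurable
    _ ≤ ∫⁻ _ : Fin n → unitInterval,
          (n.factorial : ℝ≥0∞) * (((1 + η : ℝ≥0) : ℝ≥0∞) * OPT P X) := by
        refine lintegral_mono fun v => ?_
        set m : Fin n → ℝ≥0 := fun i => smoothingFactor η (v i)
        calc ∑ σ : Equiv.Perm (Fin n), ∫⁻ ω, p.reward σ (fun i => smoothed X η i (ω, v)) ∂P
            ≤ ∑ σ : Equiv.Perm (Fin n), ((1 + η : ℝ≥0) : ℝ≥0∞) *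
                ∫⁻ ω, (p.rescale m).reward σ (fun i => X i ω) ∂P := by
              refine Finset.sum_le_sum fun σ _ => ?_
              rw [← lintegral_const_mul' _ _ ENNReal.coe_ne_top]
              exact lintegral_mono fun ω =>
                p.reward_mul_le (m := m) (fun i => smoothingFactor_le η (v i)) σ _
          _ ≤ _ := by
              rw [← Finset.mul_sum, mul_left_comm]
              exact mul_le_mul_right (sum_lintegral_reward_le _) _
    _ = (n.factorial : ℝ≥0∞) * (((1 + η : ℝ≥0) : ℝ≥0∞) * OPT P X) := by simp

/-- Small prophets in random order: the Kertz bound up to the factor `(1 - ε) ^ 3`. -/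
theorem SolvesThresholdODE.mul_MAX_le_OPT {β : ℝ} {y : ℝ → ℝ} (h : SolvesThresholdODE β y)
    (hm : ∀ i, Measurable (X i)) (hX : iIndepFun X P) {ε : ℝ}
    (hε0 : 0 ≤ ε) (hε : ε < 1) (hs : ∀ i, IsSmall P (X i) ε 0) :
    ENNReal.ofReal ((1 - ε) ^ 3 * β) * MAX P X ≤ OPT P X := by
  have key : ∀ η : ℝ≥0, 0 < η → ENNReal.ofReal ((1 - ε) ^ 3 * β) * MAX P X ≤
      ((1 + η : ℝ≥0) : ℝ≥0∞) * OPT P X := fun η hη =>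
    calc ENNReal.ofReal ((1 - ε) ^ 3 * β) * MAX P X
        ≤ ENNReal.ofReal ((1 - ε) ^ 3 * β) * MAX (P.prod volume) (smoothed X η) :=
          mul_le_mul_right (MAX_le_MAX_smoothed hm η) _
      _ ≤ ALG (P.prod volume) (smoothed X η)
            (fun t => maxCDFInv (P.prod volume) (smoothed X η) (y t)) ((1 - ε) ^ 2) :=
          h.mul_MAX_le_ALG (measurable_smoothed hm η) (iIndepFun_smoothed hm hX η)
            (continuous_maxCDF_smoothed hm hη) hε0 hε fun i => isSmall_smoothed hm (hs i) η
      _ ≤ OPT (P.prod volume) (smoothed X η) :=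
          ALG_le_OPT (measurable_smoothed hm η) h.measurable_threshold _
      _ ≤ _ := OPT_smoothed_le hm η
  refine ENNReal.le_of_forall_pos_le_add fun δ hδ hfin => ?_
  lift OPT P X to ℝ≥0 using hfin.ne with b hb
  -- This `η` makes `η b ≤ δ`; the `+ 1` covers `b = 0`.
  refine (key (δ / (b + 1)) (by positivity)).trans ?_
  rw [← ENNReal.coe_mul, ← ENNReal.coe_add, ENNReal.coe_le_coe, add_mul, one_mul]
  refine add_le_add_right ?_ _
  rw [div_mul_eq_mul_div, div_le_iff₀ (by positivity)]
  exact mul_le_mul_right le_self_add _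

end Smoothing

lemma sub_three_mul_le {β ε : ℝ} (hβ0 : 0 ≤ β) (hβ1 : β ≤ 1) (h0 : 0 ≤ ε) (h1 : ε ≤ 1) :
    β - 3 * ε ≤ (1 - ε) ^ 3 * β := by
  have h2 : 1 - 3 * ε ≤ (1 - ε) ^ 3 := by
    nlinarith [mul_nonneg (sq_nonneg ε) (show 0 ≤ 3 - ε by linarith)]
  nlinarith

end SmallProphets

end

theorem theorem3p3 :
    (∃! β : ℝ, SmallProphets.IsKertzBound β) ∧
    (∀ β : ℝ, SmallProphets.IsKertzBound β ↔ ∃ y : ℝ → ℝ, SmallProphets.SolvesThresholdODE β y) ∧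
    ∃ C : ℝ, 0 < C ∧ ∀ β : ℝ, SmallProphets.IsKertzBound β →
      ∀ (Ω : Type*) [MeasurableSpace Ω] (P : Measure Ω) [IsProbabilityMeasure P]
        (n : ℕ) (X : Fin n → Ω → ℝ≥0) (ε : ℝ),
        0 ≤ ε → ε ≤ 1 →
        (∀ i, Measurable (X i)) → iIndepFun X P →
        (∀ i, SmallProphets.IsSmall P (X i) ε 0) →
        ENNReal.ofReal (β - C * ε) * SmallProphets.MAX P X ≤ SmallProphets.OPT P X ∧
        (Continuous (SmallProphets.maxCDF P X) →
          ∀ y : ℝ → ℝ, SmallProphets.SolvesThresholdODE β y →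
            ENNReal.ofReal (β - C * ε) * SmallProphets.MAX P X ≤
              SmallProphets.ALG P X (fun t => SmallProphets.maxCDFInv P X (y t)) ((1 - ε) ^ 2) ∧
            SmallProphets.ALG P X (fun t => SmallProphets.maxCDFInv P X (y t)) ((1 - ε) ^ 2) ≤
              SmallProphets.OPT P X) := by
  refine ⟨SmallProphets.existsUnique_isKertzBound,
    SmallProphets.isKertzBound_iff_exists_solvesThresholdODE, 3, by norm_num, ?_⟩
  intro β hβ Ω _ P _ n X ε hε0 hε1 hm hX hs
  have hconst : ENNReal.ofReal (β - 3 * ε) ≤ ENNReal.ofReal ((1 - ε) ^ 3 * β) :=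
    ENNReal.ofReal_le_ofReal
      (SmallProphets.sub_three_mul_le hβ.pos.le hβ.lt_one.le hε0 hε1)
  -- The logarithmic estimates need `ε < 1`. At `ε = 1` the factor `β - 3` is negative and
  -- `ENNReal.ofReal` truncates it to `0`.
  rcases hε1.eq_or_lt with rfl | hε
  · have hzero : ENNReal.ofReal (β - 3 * 1) = 0 :=
      ENNReal.ofReal_of_nonpos (by linarith [hβ.lt_one])
    rw [hzero, zero_mul]
    refine ⟨zero_le, fun _ y hy => ⟨zero_le, ?_⟩⟩
    exact SmallProphets.ALG_le_OPT hm hy.measurable_threshold _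
  · obtain ⟨y₀, hy₀⟩ := hβ.exists_solvesThresholdODE
    refine ⟨(mul_le_mul_left hconst _).trans (hy₀.mul_MAX_le_OPT hm hX hε0 hε hs),
      fun hF y hy => ⟨(mul_le_mul_left hconst _).trans
        (hy.mul_MAX_le_ALG hm hX hF hε0 hε hs), ?_⟩⟩
    exact SmallProphets.ALG_le_OPT hm hy.measurable_threshold _
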